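/- Let $k$ be an algebraically closed field and let $\mathbf C$ be a finite length category over $k$: an essentially small $k$-linear abelian category in which all objects have finite length and all morphism spaces are finite dimensional. Let $\Lambda$ be a set labelling the isomorphism classes of simple objects $L(\lambda)$, $\lambda\in\Lambda$, of $\mathbf C$, and let $\le$ be a lower finite partial order on $\Lambda$, that is, ${\le}\lambda:=\{\mu\in\Lambda\mid\mu\le\lambda\}$ is finite for every $\lambda\in\Lambda$. An ideal of $\Lambda$ is a lower set. For $\Omega\subseteq\Lambda$ let $\mathbf C_\Omega$ be the Serre subcategory of $\mathbf C$ generated by the $L(\lambda)$ with $\lambda\in\Omega$, and let $\Gamma_\Omega:\mathrm{Ind}\,\mathbf C\to\mathrm{Ind}\,\mathbf C_\Omega$ be right adjoint to the inclusion. Let $I(\lambda)$ be the injective hull of $L(\lambda)$ in $\mathrm{Ind}\,\mathbf C$. A $k$-linear abelian category is called finite if it is a finite length category over $k$ and has an object $G$ such that the only full additive subcategory that contains $G$ and is closed under subquotients is the whole category. Say that $(\mathbf C,\le)$ is a lower finite highest weight category in the $*$-sense if for each $\lambda\in\Lambda$: (i$*$) the category $\mathbf C_{\le\lambda}$ is finite;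 (ii$*$) $[\nabla(\lambda):L(\lambda)]=1$, where $\nabla(\lambda):=\Gamma_{\le\lambda}I(\lambda)\in\mathbf C_{\le\lambda}$; (iii$*$) $I(\lambda)$ is the union of a directed set of subobjects $I_\alpha\subseteq I(\lambda)$, each of which lies in $\mathbf C$ and has a finite filtration with all quotients isomorphic to objects $\nabla(\mu)$ with $\mu\ge\lambda$. Say that $(\mathbf C,\le)$ is a lower finite highest weight category in the $\dagger$-sense if for each $\lambda\in\Lambda$: (i$\dagger$) $L(\lambda)$ has an injective hull $\nabla(\lambda)$ and a projective cover $\Delta(\lambda)$ in $\mathbf C_{\le\lambda}$; (ii$\dagger$) $[\nabla(\lambda):L(\lambda)]=1$, and $\nabla(\lambda)$ is injective in $\mathbf C_\Omega$ for each finite ideal $\Omega\ni\lambda$ in which $\lambda$ is maximal; (iii$\dagger$) $\mathrm{Ext}^2_{\mathbf C}(\Delta(\lambda),\nabla(\mu))=0$ for each $\mu\in\Lambda$. Then $(\mathbf C,\le)$ is a lower finite highest weight category in the $*$-sense if and only if it is one in the $\dagger$-sense. Moreover, the $\dagger$-conditions imply the additional conditions of Riche and Williamson: for each $\lambda\in\Lambda$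 one has $[\Delta(\lambda):L(\lambda)]=1$, and $\Delta(\lambda)$ is projective in $\mathbf C_\Omega$ for each finite ideal $\Omega\ni\lambda$ in which $\lambda$ is maximal. Hence the $\dagger$-sense is also equivalent to the $\dagger$-conditions together with these additional conditions. -/

import Mathlib

open CategoryTheory CategoryTheory.Limits

universe w v u

namespace LFHW

section FiniteLength

variable (k : Type*) [Field k] (A : Type*) [Category* A] [Abelian A] [Linear k A]

/-- The finiteness conditions in the definition of a finite length category over `k`: all objects
have finite length (i.e. are noetherian and artinian) and all morphism spaces are finite
dimensional. Essential smallness is expressed separately by Mathlib's `EssentiallySmall`. -/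
structure IsFiniteLengthCategory : Prop where
  noetherian : ∀ X : A, IsNoetherianObject X
  artinian : ∀ X : A, IsArtinianObject X
  finite_hom : ∀ X Y : A, Module.Finite k (X ⟶ Y)

/-- A topologising subcategory: a full additive subcategory closed under subquotients. -/
structure IsTopologising {A : Type*} [Category* A] [Abelian A] (P : ObjectProperty A) : Prop where
  containsZero : P.ContainsZero
  biprod : ∀ X Y : A, P X → P Y → P (X ⊞ Y)
  closedUnderSubobjects : P.IsClosedUnderSubobjects
  closedUnderQuotients : P.IsClosedUnderQuotients

/-- A finite category over `k`: a finite length category which is equal to its topologising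
subcategory generated by a single object `G`. -/
structure IsFiniteCategory : Prop extends IsFiniteLengthCategory k A where
  exists_generator : ∃ G : A, ∀ P : ObjectProperty A, IsTopologising P → P G → ∀ X : A, P X

end FiniteLength

section Hulls

variable {D : Type*} [Category* D]

/-- `i : X ⟶ E` exhibits `E` as an injective hull of `X`: `E` is injective and `i` is an essential
monomorphism. -/
structure IsInjectiveHull {X E : D} (i : X ⟶ E) : Prop where
  mono : Mono i
  injective : Injective E
  essential : ∀ ⦃Z : D⦄ (g : E ⟶ Z), Mono (i ≫ g) → Mono g

/-- `p : P ⟶ X` exhibits `P` as a projective cover of `X`: `P` is projective and `p` is an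
essential (superfluous) epimorphism. -/
structure IsProjectiveCover {P X : D} (p : P ⟶ X) : Prop where
  epi : Epi p
  projective : Projective P
  superfluous : ∀ ⦃Z : D⦄ (g : Z ⟶ P), Epi (g ≫ p) → Epi g

end Hulls

section Filtrations

variable {C : Type u} [Category.{v} C] [Abelian C]

/-- `HasFiltration l X`: the object `X` has a finite filtration by subobjects
`0 = Xₙ ⊆ ⋯ ⊆ X₁ ⊆ X₀ = X` whose successive quotients `X₀/X₁, X₁/X₂, …` form the list `l`. -/
inductive HasFiltration : List C → C → Prop
  | nil {X : C} (hX : IsZero X) : HasFiltration [] X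
  | cons {l : List C} {S : ShortComplex C} (hS : S.ShortExact) (h : HasFiltration l S.X₁) :
      HasFiltration (S.X₃ :: l) S.X₂

open Classical in
/-- `HasMultiplicity X S n`: the Jordan–Hölder multiplicity `[X : S]` equals `n`, that is, `X` has
a composition series in which exactly `n` of the factors are isomorphic to `S`. -/
def HasMultiplicity (X S : C) (n : ℕ) : Prop :=
  ∃ l : List C, HasFiltration l X ∧ (∀ T ∈ l, Simple T) ∧
    l.countP (fun T => decide (Nonempty (T ≅ S))) = n

/-- The vanishing of `Extⁿ(X, Y)` in the abelian category `C`. -/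
def ExtVanishes (X Y : C) (n : ℕ) : Prop :=
  letI : HasExt.{max u v} C := HasExt.standard C
  ∀ e : Abelian.Ext.{max u v} X Y n, e = 0

end Filtrations

section Labelling

variable {C : Type u} [Category.{v} C] [Abelian C] {Λ : Type*}

/-- `L` labels the isomorphism classes of simple objects of `C` by the set `Λ`. -/
structure IsSimpleLabelling (L : Λ → C) : Prop where
  simple : ∀ a, Simple (L a)
  injective : ∀ a b, Nonempty (L a ≅ L b) → a = b
  surjective : ∀ S : C, Simple S → ∃ a, Nonempty (S ≅ L a)

/-- The Serre subcategory `C_Ω` of `C` generated by the objects `L a` for `a ∈ Ω`, as a property of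
objects of `C`: an object belongs to it if it belongs to every Serre subcategory containing them. -/
def serreSub (L : Λ → C) (Ω : Set Λ) : ObjectProperty C :=
  fun X => ∀ P : ObjectProperty C, P.IsSerreClass → (∀ a ∈ Ω, P (L a)) → P X

lemma serreSub_mem (L : Λ → C) {Ω : Set Λ} {a : Λ} (ha : a ∈ Ω) : serreSub L Ω (L a) :=
  fun _ _ h => h a ha

lemma serreSub_mono (L : Λ → C) {Ω Ω' : Set Λ} (h : Ω ⊆ Ω') : serreSub L Ω ≤ serreSub L Ω' :=
  fun _ hX P hP hL => hX P hP fun a ha => hL a (h ha)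

instance (L : Λ → C) (Ω : Set Λ) : (serreSub L Ω).IsSerreClass where
  exists_zero := ⟨_, isZero_zero C, fun P _ _ => P.prop_of_isZero (isZero_zero C)⟩
  prop_of_mono f _ hY := fun P hP h => P.prop_of_mono f (hY P hP h)
  prop_of_epi f _ hX := fun P hP h => P.prop_of_epi f (hX P hP h)
  prop_X₂_of_shortExact hS h₁ h₃ :=
    fun P hP h => P.prop_X₂_of_shortExact hS (h₁ P hP h) (h₃ P hP h)

instance (L : Λ → C) (Ω : Set Λ) : (serreSub L Ω).IsClosedUnderFiniteProducts := by
  have : (serreSub L Ω).IsClosedUnderBinaryProducts := by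
    refine ⟨?_⟩
    rintro X ⟨p⟩
    have h₁ := p.prop_diag_obj ⟨WalkingPair.left⟩
    have h₂ := p.prop_diag_obj ⟨WalkingPair.right⟩
    refine (serreSub L Ω).prop_of_iso ?_ ((serreSub L Ω).prop_biprod h₁ h₂)
    exact (biprod.isoProd _ _) ≪≫
      (HasLimit.isoOfNatIso (diagramIsoPair p.diag)).symm ≪≫
      (limit.isLimit p.diag).conePointUniqueUpToIso p.isLimit
  exact ObjectProperty.IsClosedUnderFiniteProducts.mk'

/-- The category `C_Ω`. It is an abelian category. -/
abbrev Trunc (L : Λ → C) (Ω : Set Λ) := (serreSub L Ω).FullSubcategory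

/-- The inclusion `C_Ω ⥤ C_Ω'` for `Ω ⊆ Ω'`. -/
abbrev truncIncl (L : Λ → C) {Ω Ω' : Set Λ} (h : Ω ⊆ Ω') : Trunc L Ω ⥤ Trunc L Ω' :=
  ObjectProperty.ιOfLE (serreSub_mono L h)

/-- The simple object `L a`, as an object of `C_Ω` for `a ∈ Ω`. -/
abbrev truncSimple (L : Λ → C) {Ω : Set Λ} {a : Λ} (ha : a ∈ Ω) : Trunc L Ω :=
  ⟨L a, serreSub_mem L ha⟩

end Labelling

section Ind

variable (C : Type u) [Category.{v} C] [EssentiallySmall.{w} C]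

/-- The ind-completion of an essentially small category `C`, formed on a small model of `C`. -/
abbrev IndCompletion := Ind (SmallModel.{w} C)

/-- The canonical fully faithful functor from `C` to its ind-completion. -/
noncomputable abbrev toInd : C ⥤ IndCompletion.{w} C :=
  (equivSmallModel.{w} C).functor ⋙ Ind.yoneda

variable {C} [Abelian C] {Λ : Type*}

/-- The morphism `g : N ⟶ I` in the ind-completion, with `N` in `C_Ω`, exhibits `N` as `Γ_Ω I`,
where `Γ_Ω` is right adjoint to the inclusion: each morphism to `I` from an object of `C_Ω` factors
uniquely through `g`. -/
def IsGamma (L : Λ → C) (Ω : Set Λ) {I : IndCompletion.{w} C} (N : Trunc L Ω)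
    (g : (toInd C).obj N.obj ⟶ I) : Prop :=
  ∀ (X : Trunc L Ω) (f : (toInd C).obj X.obj ⟶ I),
    ∃! h : X.obj ⟶ N.obj, (toInd C).map h ≫ g = f

end Ind

section HighestWeight

variable (k : Type*) [Field k] {C : Type u} [Category.{v} C] [Abelian C] [Linear k C]
  {Λ : Type*} [PartialOrder Λ] (L : Λ → C)

/-- Lower finite highest weight category, `∗`-version. Here `ι a : L a ⟶ I a` is the injective hull
of `L a` in the ind-completion and `nabla a = Γ_{≤ a} (I a)`, all unique up to isomorphism. -/
def IsLowerFiniteHWStar [EssentiallySmall.{w} C] : Prop :=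
  ∃ (I : Λ → IndCompletion.{w} C) (ι : ∀ a, (toInd C).obj (L a) ⟶ I a)
    (nabla : ∀ a, Trunc L (Set.Iic a)) (g : ∀ a, (toInd C).obj (nabla a).obj ⟶ I a),
    (∀ a, IsInjectiveHull (ι a)) ∧ (∀ a, IsGamma L (Set.Iic a) (nabla a) (g a)) ∧
    ∀ a,
      -- the category `C_{≤ a}` is finite abelian
      IsFiniteCategory k (Trunc L (Set.Iic a)) ∧
      -- `[∇(a) : L(a)] = 1`
      HasMultiplicity (nabla a).obj (L a) 1 ∧
      -- `I(a)` is the union of a directed set of subobjects in `C`, each of which has a finite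
      -- filtration with all quotients isomorphic to some `∇(b)` with `b ≥ a`
      ∃ 𝒮 : Set (Subobject (I a)), 𝒮.Nonempty ∧ DirectedOn (· ≤ ·) 𝒮 ∧ IsLUB 𝒮 ⊤ ∧
        ∀ S ∈ 𝒮, ∃ (X : C) (l : List C), Nonempty ((toInd C).obj X ≅ (S : IndCompletion.{w} C)) ∧
          HasFiltration l X ∧ ∀ Q ∈ l, ∃ b, a ≤ b ∧ Nonempty (Q ≅ (nabla b).obj)

/-- The three defining conditions of the `†`-version, for all labels `a`, where `delta a` and
`nabla a` are the standard and costandard objects. -/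
def DaggerConditions (delta nabla : ∀ a : Λ, Trunc L (Set.Iic a)) : Prop :=
  ∀ a,
    -- `∇(a)` is an injective hull and `Δ(a)` a projective cover of `L(a)` in `C_{≤ a}`
    ((∃ i : truncSimple L (Set.self_mem_Iic (a := a)) ⟶ nabla a, IsInjectiveHull i) ∧
      ∃ p : delta a ⟶ truncSimple L (Set.self_mem_Iic (a := a)), IsProjectiveCover p) ∧
    -- `[∇(a) : L(a)] = 1`, and `∇(a)` is injective in `C_Ω` for all finite ideals `Ω` in which `a`
    -- is maximal
    (HasMultiplicity (nabla a).obj (L a) 1 ∧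
      ∀ (Ω : Set Λ) (hΩ : IsLowerSet Ω), Ω.Finite → ∀ ha : Maximal (· ∈ Ω) a,
        Injective ((truncIncl L (hΩ.Iic_subset ha.prop)).obj (nabla a))) ∧
    -- `Ext²(Δ(a), ∇(b)) = 0` in `C`
    ∀ b, ExtVanishes (delta a).obj (nabla b).obj 2

/-- Lower finite highest weight category, `†`-version. -/
def IsLowerFiniteHWDagger : Prop :=
  ∃ delta nabla : ∀ a : Λ, Trunc L (Set.Iic a), DaggerConditions L delta nabla

/-- The additional conditions of Riche and Williamson on the standard objects: `[Δ(a) : L(a)] = 1`,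
and `Δ(a)` is projective in `C_Ω` for all finite ideals `Ω` in which `a` is maximal. -/
def RWConditions (delta : ∀ a : Λ, Trunc L (Set.Iic a)) : Prop :=
  ∀ a, HasMultiplicity (delta a).obj (L a) 1 ∧
    ∀ (Ω : Set Λ) (hΩ : IsLowerSet Ω), Ω.Finite → ∀ ha : Maximal (· ∈ Ω) a,
      Projective ((truncIncl L (hΩ.Iic_subset ha.prop)).obj (delta a))

/-- Highest weight category in the sense of Riche and Williamson: the `†`-version together with the
additional conditions on standard objects. -/
def IsHighestWeightRW : Prop :=
  ∃ delta nabla : ∀ a : Λ, Trunc L (Set.Iic a), DaggerConditions L delta nabla ∧ RWConditions L delta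

end HighestWeight

end LFHW

/-! Everything is expressed by Ext groups of `C`. Since `C_Ω` is closed under extensions,
injectivity or projectivity in `C_Ω` means vanishing of `Ext¹` against `C_Ω` (`trunc_injective_iff`,
`trunc_projective_iff`). As `C` need not have enough injectives or projectives, dimension shifting
rests on effaceability of Ext (`exists_epi_comp_eq_zero`).

Additional conditions. Let rad Δ(a) be the kernel of Δ(a) → L(a). Injectivity of ∇(a) in `C_{≤ a}`
and [∇(a) : L(a)] = 1 leave no nonzero map rad Δ(a) → ∇(a), so rad Δ(a) lies in `C_{< a}`
(`IsStandard.kernel_mem`). If a is maximal in Ω and b ∈ Ω, then Ext¹(Δ(a), ∇(b)) and Hom(Δ(a),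
∇(b)/L(b)) vanish, hence so does Ext¹(Δ(a), L(b)) (`IsStandard.ext_one_of_maximal`).

From † to ∗. For each finite ideal Ω a ∇-filtered injective hull of L(a) in `C_Ω` is built by adding
one maximal label b at a time (`exists_isPartialHull`). While Ext¹(L(b), J) ≠ 0, a nonzero class
extends to ∇(b), the obstruction lying in Ext²(∇(b)/L(b), J) = 0, and gives a larger essential
extension (`IsPartialHull.enlarge`). This raises dim Hom(Δ(b), J) but not its bound dim Hom(rad
Δ(b), J), so the process stops. The hulls are the largest subobjects of I(a) in the `C_Ω`, and I(a)
is their union (`IsPartialHull.exists_gamma`, `exists_directed_union`); they also make `C_{≤ a}`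
finite (`isFiniteCategory_trunc`).

From ∗ to †. Finite categories have projective covers (`IsFiniteCategory.exists_isProjectiveCover`).
By compactness, a morphism from an object of `C` to I(a) lands in a ∇-filtered subobject; if the
source is in `C_Ω` with a maximal in Ω, its image lies in `C_{≤ a}`, hence in ∇(a), which gives
injectivity of ∇(a) (`exists_isCostandard`). A class in Ext²(Δ(a), ∇(b)) dies in some E ⊇ ∇(b),
hence in a ∇-filtered Y ⊆ I(b). With the copies of ∇(b) collected in Y' ⊆ Y, it dies already in Y',
because Ext¹(Δ(a), Y/Y') = 0; and ∇(b) is a direct summand of Y' (`ext_two_standard_costandard`). -/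

namespace LFHW

/-! ### Effaceability of Ext in an arbitrary abelian category -/

section Effaceability

open DerivedCategory HomologicalComplex

variable {C : Type u} [Category.{v} C] [Abelian C]

/-- Since `K` vanishes above degree `i`, all of `K.X i` consists of cycles and surjects onto the
homology in degree `i`, which `π` identifies with `X`. This surjection serves as `p`. -/
lemma exists_epi_lift_to_single {X : C} {K : CochainComplex C ℤ} {i : ℤ}
    (π : K ⟶ (single C (ComplexShape.up ℤ) i).obj X) [K.IsStrictlyLE i] [QuasiIsoAt π i] :
    ∃ (X' : C) (p : X' ⟶ X) (_ : Epi p) (σ : (single C (ComplexShape.up ℤ) i).obj X' ⟶ K),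
      σ ≫ π = (single C (ComplexShape.up ℤ) i).map p := by
  have hd : K.d i (i + 1) = 0 :=
    (K.isZero_of_isStrictlyLE i (i + 1) (by simp)).eq_of_tgt _ _
  let e := K.iCyclesIso i (i + 1) (by simp) hd
  let α := e.inv ≫ K.homologyπ i ≫ homologyMap π i ≫ (singleObjHomologySelfIso _ _ _).hom
  have hα : Epi α := by
    have : IsIso (homologyMap π i) := inferInstance
    exact epi_comp' inferInstance (epi_comp' inferInstance (epi_comp' inferInstance inferInstance))
  have : π.f i = α ≫ (singleObjXSelf (ComplexShape.up ℤ) i X).inv := by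
    rw [← cancel_epi e.hom]
    dsimp only [α, e]
    rw [Category.assoc, Category.assoc, Category.assoc, Iso.hom_inv_id_assoc,
      homologyπ_naturality_assoc,
      homologyπ_singleObjHomologySelfIso_hom_assoc,
      ← singleObjCyclesSelfIso_inv_iCycles, Iso.hom_inv_id_assoc]
    exact (cyclesMap_i π i).symm
  refine ⟨K.X i, α, hα, mkHomFromSingle (𝟙 _) (fun k hk => ?_), ?_⟩
  · have hk' : i + 1 = k := hk
    subst hk'
    rw [hd, comp_zero]
  · apply HomologicalComplex.from_single_hom_ext
    rw [comp_f, mkHomFromSingle_f, Category.assoc, this, single_map_f_self,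
      Category.id_comp]

/-- A morphism in the derived category is a fraction through some `K` concentrated in degrees at
most `i`. After pullback along an epimorphism it becomes a chain map from a complex in degree `i`,
where `L` is zero. -/
lemma exists_epi_single_map_comp_eq_zero [HasDerivedCategory.{w} C] {X : C}
    {L : CochainComplex C ℤ} {i : ℤ}
    (φ : Q.obj ((single C (ComplexShape.up ℤ) i).obj X) ⟶ Q.obj L)
    (n : ℤ) (hn : n < i) [L.IsStrictlyLE n] :
    ∃ (X' : C) (p : X' ⟶ X) (_ : Epi p),
      Q.map ((single C (ComplexShape.up ℤ) i).map p) ≫ φ = 0 := by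
  obtain ⟨K, _, π, h, g, rfl⟩ := right_fac_of_isStrictlyLE φ i
  have h' := (isIso_Q_map_iff_quasiIso _ _).1 h
  obtain ⟨X', p, hp, σ, hσ⟩ := exists_epi_lift_to_single π
  refine ⟨X', p, hp, ?_⟩
  have h₂ : σ ≫ g = 0 := by
    apply HomologicalComplex.from_single_hom_ext
    apply (L.isZero_of_isStrictlyLE n i hn).eq_of_tgt
  rw [← hσ, Q.map_comp, Category.assoc, IsIso.hom_inv_id_assoc, ← Q.map_comp, h₂, Q.map_zero]

/-- Every class in `Extⁿ⁺¹(X, Y)` is killed by the pullback along some epimorphism to `X`. -/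
theorem exists_epi_comp_eq_zero [HasExt.{w} C] {X Y : C} {n : ℕ} (e : Abelian.Ext X Y (n + 1)) :
    ∃ (X' : C) (p : X' ⟶ X) (_ : Epi p),
      (Abelian.Ext.mk₀ p).comp e (zero_add (n + 1)) = 0 := by
  let := HasDerivedCategory.standard C
  -- The shift of `Y` by `n + 1` is the single complex in degree `-(n + 1)`, which vanishes in
  -- degree `0`.
  let t := ((singleFunctors C).shiftIso ((n + 1 : ℕ) : ℤ) (-(n + 1)) 0 (by lia)).hom.app Y
  obtain ⟨X', p, hp, h⟩ := exists_epi_single_map_comp_eq_zero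
    (L := (single C (ComplexShape.up ℤ) (-(n + 1))).obj Y) (n := -(n + 1)) (i := 0)
    (e.hom ≫ t) (by lia)
  refine ⟨X', p, hp, ?_⟩
  apply Abelian.Ext.homEquiv.injective
  rw [← cancel_mono t]
  change ((Abelian.Ext.mk₀ p).comp e _).hom ≫ _ = (0 : Abelian.Ext X' Y (n + 1)).hom ≫ _
  rw [← Abelian.Ext.singleFunctor_map_comp_hom, Abelian.Ext.zero_hom, Limits.zero_comp,
    Category.assoc]
  exact h

end Effaceability

/-! ### The abstract properties of the embedding into the ind-completion -/

section CompactEmbedding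

variable {C : Type u} [Category.{v} C] {D : Type*} [Category* D]

/-- The properties of the embedding of `C` into its ind-completion which matter here: it is fully
faithful and exact, its image separates, and its values are compact with respect to directed
unions of subobjects. -/
structure IsCompactEmbedding [Abelian C] [Abelian D] (T : C ⥤ D) : Prop where
  full : T.Full
  faithful : T.Faithful
  preservesFiniteLimits : PreservesFiniteLimits T
  preservesFiniteColimits : PreservesFiniteColimits T
  enoughInjectives : EnoughInjectives D
  separating : ∀ {X Y : D} (f : X ⟶ Y), (∀ (Z : C) (u : T.obj Z ⟶ X), u ≫ f = 0) → f = 0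
  exists_isLUB : ∀ {E : D} (𝒮 : Set (Subobject E)), ∃ U, IsLUB 𝒮 U
  factors : ∀ {E : D} (𝒮 : Set (Subobject E)), 𝒮.Nonempty → DirectedOn (· ≤ ·) 𝒮 →
    ∀ U, IsLUB 𝒮 U → ∀ (X : C) (f : T.obj X ⟶ E), U.Factors f → ∃ S ∈ 𝒮, S.Factors f

end CompactEmbedding

/-! ### Compactness and separation in the ind-completion -/

section Ind

variable {C : Type v} [SmallCategory C]

/-- The inclusion into presheaves preserves filtered colimits, and by Yoneda a morphism from `X` is
a section over `X`, so it comes from a stage of the colimit. -/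
lemma ind_factors_colimit {J : Type v} [SmallCategory J] [IsFiltered J] {F : J ⥤ Ind C}
    {c : Cocone F} (hc : IsColimit c) (X : C) (f : Ind.yoneda.obj X ⟶ c.pt) :
    ∃ j, ∃ g : Ind.yoneda.obj X ⟶ F.obj j, g ≫ c.ι.app j = f := by
  let G : Ind C ⥤ Type v := Ind.inclusion C ⋙ (evaluation _ _).obj (Opposite.op X)
  let i := (Ind.yonedaCompInclusion (C := C)).app X
  obtain ⟨j, g, hg⟩ := Types.jointly_surjective_of_isColimit (isColimitOfPreserves G hc)
    (yonedaEquiv (i.inv ≫ (Ind.inclusion C).map f))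
  refine ⟨j, Ind.inclusion.fullyFaithful.preimage (i.hom ≫ yonedaEquiv.symm g), ?_⟩
  apply Ind.inclusion.fullyFaithful.map_injective
  rw [Functor.map_comp, Functor.FullyFaithful.map_preimage, Category.assoc, ← Iso.eq_inv_comp]
  apply yonedaEquiv.injective
  rw [← hg, yonedaEquiv_comp, Equiv.apply_symm_apply]
  rfl

variable [Abelian C]

/-- In a Grothendieck category a directed union of subobjects is their colimit, so compactness of
`X` applies. -/
lemma ind_factors {E : Ind C} (𝒮 : Set (Subobject E)) (hne : 𝒮.Nonempty)
    (hd : DirectedOn (· ≤ ·) 𝒮) (U : Subobject E) (hU : IsLUB 𝒮 U) (X : C)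
    (f : Ind.yoneda.obj X ⟶ E) (hf : U.Factors f) : ∃ S ∈ 𝒮, S.Factors f := by
  -- The family is reindexed by a type in the universe of the available colimits.
  obtain ⟨J, ⟨e⟩⟩ : ∃ J : Type v, Nonempty (J ≃ 𝒮) := ⟨Shrink.{v} 𝒮, ⟨(equivShrink _).symm⟩⟩
  let : Preorder J := Preorder.lift e
  have : Nonempty J := ⟨e.symm ⟨_, hne.some_mem⟩⟩
  have he : ∀ (j : J) (S : 𝒮), e j ≤ S → j ≤ e.symm S := fun j S h => by
    change e j ≤ e (e.symm S)
    rwa [e.apply_symm_apply]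
  have : IsDirectedOrder J := ⟨fun i j => by
    obtain ⟨z, hz, h₁, h₂⟩ := hd _ (e i).2 _ (e j).2
    exact ⟨e.symm ⟨z, hz⟩, he i ⟨z, hz⟩ h₁, he j ⟨z, hz⟩ h₂⟩⟩
  have hmono : Monotone (fun j : J => (e j : Subobject E)) := fun i j h => h
  let F : J ⥤ MonoOver E :=
    (hmono.functor : J ⥤ Subobject E) ⋙ (Subobject.representative : Subobject E ⥤ MonoOver E)
  let F' := F ⋙ MonoOver.forget E ⋙ Over.forget E
  let m : colimit F' ⟶ E := colimit.desc F'
    ⟨E, { app := fun j => (F.obj j).obj.hom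
          naturality := fun _ _ f => (MonoOver.w (F.map f)).trans (Category.comp_id _).symm }⟩
  have hm : ∀ j, colimit.ι F' j ≫ m = (F.obj j).obj.hom := fun j => colimit.ι_desc _ _
  have := IsGrothendieckAbelian.mono_of_isColimit_monoOver F (colimit.isColimit _) m hm
  have hsup := IsGrothendieckAbelian.subobjectMk_of_isColimit_eq_iSup F (colimit.isColimit _) m hm
  have hle : U ≤ Subobject.mk m := by
    rw [hsup]
    refine hU.2 fun S hS => le_trans (le_of_eq ?_) (le_iSup _ (e.symm ⟨S, hS⟩))
    trans ((e (e.symm ⟨S, hS⟩) : 𝒮) : Subobject E)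
    · rw [e.apply_symm_apply]
    · exact (Subobject.mk_arrow _).symm
  obtain ⟨g, hg⟩ := (Subobject.mk_factors_iff _ _).1 (Subobject.factors_of_le f hle hf)
  obtain ⟨j, l, hl⟩ := ind_factors_colimit (colimit.isColimit F') X g
  refine ⟨e j, (e j).2, (Subobject.factors_iff _ _).2 ⟨l, ?_⟩⟩
  rw [← hg, ← hl]
  exact ((Category.assoc _ _ _).trans (congrArg (l ≫ ·) (hm j))).symm

lemma ind_separating {X Y : Ind C} (f : X ⟶ Y)
    (h : ∀ (Z : C) (u : Ind.yoneda.obj Z ⟶ X), u ≫ f = 0) : f = 0 := by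
  apply Ind.isSeparating_range_yoneda
  rintro _ ⟨Z⟩ u
  rw [h, comp_zero]

end Ind

/-! ### Transport along the small model -/

section SmallModel

variable {C : Type u} [Category.{v} C] [EssentiallySmall.{w} C] [Abelian C]

noncomputable instance smallModelPreadditive : Preadditive (SmallModel.{w} C) :=
  .ofFullyFaithful (equivSmallModel C).fullyFaithfulInverse

noncomputable instance smallModelAbelian : Abelian (SmallModel.{w} C) :=
  have : HasFiniteProducts (SmallModel.{w} C) :=
    ⟨fun _ => Adjunction.hasLimitsOfShape_of_equivalence (equivSmallModel C).inverse⟩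
  abelianOfEquivalence (equivSmallModel C).inverse

theorem isCompactEmbedding_toInd : IsCompactEmbedding (toInd.{w} C) where
  full := inferInstance
  faithful := inferInstance
  preservesFiniteLimits := inferInstance
  preservesFiniteColimits := inferInstance
  enoughInjectives := inferInstance
  separating f h := ind_separating f fun Z u => by
    rw [← cancel_epi (Ind.yoneda.mapIso ((equivSmallModel C).counitIso.app Z)).hom, comp_zero,
      ← Category.assoc]
    exact h _ _
  exists_isLUB 𝒮 := ⟨sSup 𝒮, isLUB_sSup 𝒮⟩
  factors 𝒮 hne hd U hU _ f hf := ind_factors 𝒮 hne hd U hU _ f hf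

end SmallModel

/-! ### Finite length and simple objects -/

section Simple

variable {A : Type*} [Category* A] [Abelian A]

lemma shortExact_of_mono {X Y : A} (f : X ⟶ Y) [Mono f] :
    (ShortComplex.mk f (cokernel.π f) (cokernel.condition f)).ShortExact :=
  { exact := ShortComplex.exact_cokernel f
    mono_f := inferInstance
    epi_g := inferInstance }

lemma shortExact_of_epi {X Y : A} (f : X ⟶ Y) [Epi f] :
    (ShortComplex.mk (kernel.ι f) f (kernel.condition f)).ShortExact :=
  { exact := ShortComplex.exact_kernel f
    mono_f := inferInstance
    epi_g := inferInstance }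

variable (A) in
/-- All objects of `A` have finite length. -/
structure FiniteLength : Prop where
  noetherian : ∀ X : A, IsNoetherianObject X
  artinian : ∀ X : A, IsArtinianObject X

lemma FiniteLength.exists_simple_mono (h : FiniteLength A) {X : A} (hX : ¬ IsZero X) :
    ∃ (S : A) (_ : Simple S) (f : S ⟶ X), Mono f := by
  have := h.artinian X
  obtain ⟨Y, hY⟩ := exists_simple_subobject hX
  exact ⟨_, hY, Y.arrow, inferInstance⟩

/-- A property of objects containing the zero objects and the simple objects, and closed under
extensions, holds for all objects of finite length. -/
theorem FiniteLength.induction (h : FiniteLength A) (P : ObjectProperty A)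
    (h0 : ∀ X, IsZero X → P X) (hs : ∀ X, Simple X → P X)
    (hext : ∀ S : ShortComplex A, S.ShortExact → P S.X₁ → P S.X₃ → P S.X₂) (X : A) : P X := by
  have := h.noetherian X
  -- Noetherian induction on the kernel `K`, over all quotients `Q` of `X`: dividing `Q` by a simple
  -- subobject enlarges the kernel strictly.
  suffices H : ∀ (K : Subobject X) (Q : A) (p : X ⟶ Q), Epi p → kernelSubobject p = K → P Q from
    H _ X (𝟙 X) inferInstance rfl
  intro K
  induction K using WellFoundedGT.induction with
  | ind K ih =>
    intro Q p hp hK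
    by_cases hQ : IsZero Q
    · exact h0 _ hQ
    obtain ⟨S, hS, f, hf⟩ := h.exists_simple_mono hQ
    refine hext _ (shortExact_of_mono f) (hs _ hS) (ih _ ?_ _ (p ≫ cokernel.π f)
      (epi_comp _ _) rfl)
    rw [← hK]
    refine lt_of_le_of_ne (kernelSubobject_comp_le _ _) fun he => ?_
    have h1 : (kernelSubobject (p ≫ cokernel.π f)).arrow ≫ p = 0 := by
      rw [← he, kernelSubobject_arrow_comp]
    have h2 : Mono (cokernel.π f) := by
      refine Preadditive.mono_of_cancel_zero _ fun {G} g hg => ?_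
      have h3 : pullback.snd g p ≫ p ≫ cokernel.π f = 0 := by
        rw [← Category.assoc, ← pullback.condition, Category.assoc, hg, comp_zero]
      have h4 : pullback.snd g p ≫ p = 0 := by
        rw [← factorThruKernelSubobject_comp_arrow (p ≫ cokernel.π f) _ h3, Category.assoc, h1,
          comp_zero]
      rw [← pullback.condition] at h4
      rwa [← cancel_epi (pullback.fst g p), comp_zero]
    have h3 : f = 0 := by
      rw [← cancel_mono (cokernel.π f), cokernel.condition, zero_comp]
    exact id_nonzero S (by rw [← cancel_mono f, h3, comp_zero, zero_comp])

/-- A property containing the zero objects and closed under extensions is closed under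
isomorphisms. -/
lemma prop_of_iso_of_ext {P : ObjectProperty A} (h0 : ∀ X, IsZero X → P X)
    (hext : ∀ S : ShortComplex A, S.ShortExact → P S.X₁ → P S.X₃ → P S.X₂) {X Y : A} (e : X ≅ Y)
    (h : P X) : P Y :=
  hext _ (shortExact_of_mono e.hom) h (h0 _ (isZero_cokernel_of_epi e.hom))

lemma lift_of_shortExact {S : ShortComplex A} (hS : S.ShortExact) {T : A} (t : T ⟶ S.X₂)
    (h : t ≫ S.g = 0) : ∃ t' : T ⟶ S.X₁, t' ≫ S.f = t :=
  have := hS.mono_f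
  ⟨hS.exact.lift t h, hS.exact.lift_f t h⟩

lemma desc_of_shortExact {S : ShortComplex A} (hS : S.ShortExact) {T : A} (t : S.X₂ ⟶ T)
    (h : S.f ≫ t = 0) : ∃ t' : S.X₃ ⟶ T, S.g ≫ t' = t :=
  have := hS.epi_g
  ⟨hS.exact.desc t h, hS.exact.g_desc t h⟩

end Simple

/-! ### Pushouts and pullbacks of extensions -/

section Diagrams

variable {A : Type*} [Category* A] [Abelian A] {S : ShortComplex A} (hS : S.ShortExact)

include hS

/-- The pushout of an extension along a morphism from its subobject. -/
lemma exists_pushout_shortExact {Y : A} (φ : S.X₁ ⟶ Y) :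
    ∃ (E : A) (f : Y ⟶ E) (g : E ⟶ S.X₃) (w : f ≫ g = 0) (u : S.X₂ ⟶ E),
      (ShortComplex.mk f g w).ShortExact ∧ IsPushout S.f φ u f ∧ u ≫ g = S.g := by
  have hm := hS.mono_f
  have hP := IsPushout.of_hasPushout S.f φ
  let g : pushout S.f φ ⟶ S.X₃ := pushout.desc S.g 0 (by simp)
  have w : pushout.inr S.f φ ≫ g = 0 := pushout.inr_desc _ _ _
  have hu : pushout.inl S.f φ ≫ g = S.g := pushout.inl_desc _ _ _
  have := hS.epi_g
  have hepi : Epi g := by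
    have : Epi (pushout.inl S.f φ ≫ g) := by rw [hu]; infer_instance
    exact epi_of_epi (pushout.inl _ _) g
  refine ⟨_, _, g, w, pushout.inl S.f φ, ?_, hP, hu⟩
  refine { exact := ?_, mono_f := by dsimp; infer_instance, epi_g := hepi }
  apply ShortComplex.exact_of_g_is_cokernel
  refine CokernelCofork.IsColimit.ofπ _ _ (fun {W} k hk =>
    hS.exact.desc (pushout.inl _ _ ≫ k) ?_) ?_ ?_
  · dsimp at hk
    rw [← Category.assoc, pushout.condition, Category.assoc, hk, comp_zero]
  · intro W k hk
    dsimp at hk ⊢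
    apply pushout.hom_ext
    · rw [← Category.assoc, hu]
      exact hS.exact.g_desc _ _
    · rw [← Category.assoc, w, zero_comp, hk]
  · intro W k hk m hm
    dsimp at hm
    rw [← cancel_epi S.g, hS.exact.g_desc, ← hm, ← Category.assoc, hu]

/-- The pullback of an extension along a morphism to its quotient. -/
lemma exists_pullback_shortExact {Y : A} (φ : Y ⟶ S.X₃) :
    ∃ (E : A) (f : S.X₁ ⟶ E) (g : E ⟶ Y) (w : f ≫ g = 0) (u : E ⟶ S.X₂),
      (ShortComplex.mk f g w).ShortExact ∧ IsPullback u g S.g φ ∧ f ≫ u = S.f := by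
  have hm := hS.mono_f
  have he := hS.epi_g
  have hP := IsPullback.of_hasPullback S.g φ
  let f : S.X₁ ⟶ pullback S.g φ := pullback.lift S.f 0 (by simp)
  have w : f ≫ pullback.snd S.g φ = 0 := pullback.lift_snd _ _ _
  have hu : f ≫ pullback.fst S.g φ = S.f := pullback.lift_fst _ _ _
  have hmono : Mono f := by
    have : Mono (f ≫ pullback.fst S.g φ) := by rw [hu]; infer_instance
    exact mono_of_mono f (pullback.fst _ _)
  refine ⟨_, f, _, w, pullback.fst S.g φ, ?_, hP, hu⟩
  refine { exact := ?_, mono_f := hmono, epi_g := by dsimp; infer_instance }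
  apply ShortComplex.exact_of_f_is_kernel
  refine KernelFork.IsLimit.ofι _ _ (fun {W} k hk =>
    hS.exact.lift (k ≫ pullback.fst _ _) ?_) ?_ ?_
  · dsimp at hk
    rw [Category.assoc, pullback.condition, ← Category.assoc, hk, zero_comp]
  · intro W k hk
    dsimp at hk ⊢
    apply pullback.hom_ext
    · rw [Category.assoc, hu]
      exact hS.exact.lift_f _ _
    · rw [Category.assoc, w, comp_zero, hk]
  · intro W k hk m hm
    dsimp at hm
    rw [← cancel_mono S.f, hS.exact.lift_f, ← hm, Category.assoc, hu]

/-- For `T ⊆ X₁ ⊆ X₂`, the quotient `X₂ / T` is an extension of `X₂ / X₁` by `X₁ / T`. -/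
lemma exists_shortExact_quotient {T Y : A} {t : T ⟶ S.X₁} {y : S.X₁ ⟶ Y} {w : t ≫ y = 0}
    (hT : (ShortComplex.mk t y w).ShortExact) :
    ∃ (E : A) (f : Y ⟶ E) (g : E ⟶ S.X₃) (w₁ : f ≫ g = 0) (q : S.X₂ ⟶ E)
      (w₂ : (t ≫ S.f) ≫ q = 0), (ShortComplex.mk f g w₁).ShortExact ∧
      (ShortComplex.mk (t ≫ S.f) q w₂).ShortExact ∧ q ≫ g = S.g := by
  obtain ⟨E, f, g, w₁, q, h, hP, hq⟩ := exists_pushout_shortExact hS y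
  have hy : Epi y := hT.epi_g
  have ht : Mono t := hT.mono_f
  have := hS.mono_f
  refine ⟨E, f, g, w₁, q, ?_, h, ?_, hq⟩
  · rw [Category.assoc, hP.w, ← Category.assoc, w, zero_comp]
  · refine { exact := ?_, mono_f := mono_comp _ _, epi_g := hP.epi_inl_of_epi hy }
    apply ShortComplex.exact_of_g_is_cokernel
    refine CokernelCofork.IsColimit.ofπ _ _ (fun {W} k hk => hP.desc k
      (hT.exact.desc (S.f ≫ k) ?_) (hT.exact.g_desc _ _).symm) ?_ ?_
    · rw [← hk]; simp
    · intro W k hk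
      exact hP.inl_desc _ _ _
    · intro W k hk m hm
      have : Epi q := hP.epi_inl_of_epi hy
      rw [← cancel_epi q, hP.inl_desc]
      exact hm

/-- For a subobject `T` of `X₂ / X₁`, its preimage in `X₂` is an extension of `T` by `X₁`. -/
lemma exists_shortExact_preimage {T Y : A} {t : T ⟶ S.X₃} {y : S.X₃ ⟶ Y} {w : t ≫ y = 0}
    (hT : (ShortComplex.mk t y w).ShortExact) :
    ∃ (E : A) (f : S.X₁ ⟶ E) (g : E ⟶ T) (w₁ : f ≫ g = 0) (j : E ⟶ S.X₂)
      (w₂ : j ≫ S.g ≫ y = 0), (ShortComplex.mk f g w₁).ShortExact ∧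
      (ShortComplex.mk j (S.g ≫ y) w₂).ShortExact ∧ f ≫ j = S.f := by
  obtain ⟨E, f, g, w₁, j, h, hP, hj⟩ := exists_pullback_shortExact hS t
  have hy : Epi y := hT.epi_g
  have ht : Mono t := hT.mono_f
  have := hS.epi_g
  refine ⟨E, f, g, w₁, j, ?_, h, ?_, hj⟩
  · rw [← Category.assoc, hP.w, Category.assoc, w, comp_zero]
  · refine { exact := ?_, mono_f := hP.mono_fst_of_mono ht, epi_g := epi_comp _ _ }
    apply ShortComplex.exact_of_f_is_kernel
    refine KernelFork.IsLimit.ofι _ _ (fun {W} k hk => hP.lift k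
      (hT.exact.lift (k ≫ S.g) ?_) (hT.exact.lift_f _ _).symm) ?_ ?_
    · rw [← hk]; simp
    · intro W k hk
      exact hP.lift_fst _ _ _
    · intro W k hk m hm
      have : Mono j := hP.mono_fst_of_mono ht
      rw [← cancel_mono j, hP.lift_fst]
      exact hm

end Diagrams

/-! ### Serre subcategories generated by simple objects -/

section Serre

variable {C : Type u} [Category.{v} C] [Abelian C] {Λ : Type*} {L : Λ → C} {Ω : Set Λ}

/-- The smallest property containing the zero objects and the `L a` for `a ∈ Ω` and closed under
extensions. -/
def extClosure (L : Λ → C) (Ω : Set Λ) : ObjectProperty C := fun X =>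
  ∀ P : ObjectProperty C, (∀ X, IsZero X → P X) → (∀ a ∈ Ω, P (L a)) →
    (∀ S : ShortComplex C, S.ShortExact → P S.X₁ → P S.X₃ → P S.X₂) → P X

lemma extClosure_zero {X : C} (hX : IsZero X) : extClosure L Ω X := fun _ h0 _ _ => h0 _ hX

lemma extClosure_ext {S : ShortComplex C} (hS : S.ShortExact) (h₁ : extClosure L Ω S.X₁)
    (h₃ : extClosure L Ω S.X₃) : extClosure L Ω S.X₂ :=
  fun P h0 hs hext => hext S hS (h₁ P h0 hs hext) (h₃ P h0 hs hext)

lemma extClosure_simple {a : Λ} (ha : a ∈ Ω) : extClosure L Ω (L a) := fun _ _ h _ => h a ha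

lemma extClosure_iso {X Y : C} (e : X ≅ Y) (h : extClosure L Ω X) : extClosure L Ω Y :=
  prop_of_iso_of_ext (fun _ => extClosure_zero) (fun _ => extClosure_ext) e h

/-- The two outer terms are the intersection of `Y` with `X₁` and the image of `Y` in `X₃`. -/
lemma shortExact_image_left {S : ShortComplex C} (hS : S.ShortExact) {Y : C} (j : Y ⟶ S.X₂)
    [Mono j] : ∃ (K I : C) (f : K ⟶ Y) (g : Y ⟶ I) (w : f ≫ g = 0) (a : K ⟶ S.X₁) (b : I ⟶ S.X₃),
      (ShortComplex.mk f g w).ShortExact ∧ Mono a ∧ Mono b := by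
  obtain ⟨a, ha⟩ := lift_of_shortExact hS (kernel.ι (j ≫ S.g) ≫ j)
    (by rw [Category.assoc, kernel.condition])
  have := hS.mono_f
  refine ⟨kernel (j ≫ S.g), Abelian.image (j ≫ S.g), kernel.ι _, Abelian.factorThruImage _, ?_,
    a, Abelian.image.ι _, ?_, ?_, inferInstance⟩
  · rw [← cancel_mono (Abelian.image.ι (j ≫ S.g))]; simp
  · refine { exact := ?_, mono_f := by dsimp; infer_instance, epi_g := by dsimp; infer_instance }
    apply ShortComplex.exact_of_f_is_kernel
    refine KernelFork.IsLimit.ofι _ _ (fun {W} k hk => kernel.lift _ k ?_) ?_ ?_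
    · dsimp at hk
      rw [← Abelian.image.fac (j ≫ S.g), ← Category.assoc, hk, zero_comp]
    · intros; dsimp; simp
    · intro W k hk m hm
      dsimp at hm ⊢
      rw [← cancel_mono (kernel.ι (j ≫ S.g)), hm, kernel.lift_ι]
  · have : Mono (a ≫ S.f) := by rw [ha]; infer_instance
    exact mono_of_mono a S.f

lemma shortExact_image_right {S : ShortComplex C} (hS : S.ShortExact) {Y : C} (q : S.X₂ ⟶ Y)
    [Epi q] : ∃ (I K : C) (f : I ⟶ Y) (g : Y ⟶ K) (w : f ≫ g = 0) (a : S.X₁ ⟶ I) (b : S.X₃ ⟶ K),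
      (ShortComplex.mk f g w).ShortExact ∧ Epi a ∧ Epi b := by
  obtain ⟨b, hb⟩ := desc_of_shortExact hS (q ≫ cokernel.π (S.f ≫ q))
    (by rw [← Category.assoc, cokernel.condition])
  refine ⟨Abelian.image (S.f ≫ q), _, Abelian.image.ι _, cokernel.π (S.f ≫ q), ?_,
    Abelian.factorThruImage _, b, ?_, inferInstance, ?_⟩
  · exact kernel.condition _
  · exact { exact := ShortComplex.exact_kernel _
            mono_f := by dsimp; infer_instance
            epi_g := by dsimp; infer_instance }
  · have : Epi (S.g ≫ b) := by rw [hb]; exact epi_comp _ _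
    exact epi_of_epi S.g b

/-- Together with the dual statement this makes the extension closure of simple objects a Serre
subcategory, which is why induction over extensions reaches all of `C_Ω`. -/
lemma extClosure_mono (hL : ∀ a ∈ Ω, Simple (L a)) {X : C} (hX : extClosure L Ω X) :
    ∀ (Y : C) (j : Y ⟶ X), Mono j → extClosure L Ω Y := by
  refine hX (fun X => ∀ (Y : C) (j : Y ⟶ X), Mono j → extClosure L Ω Y) ?_ ?_ ?_
  · intro X hX Y j hj
    exact extClosure_zero (hX.of_mono j)
  · intro a ha Y j hj
    have := hL a ha
    by_cases h : j = 0
    · exact extClosure_zero (IsZero.of_mono_eq_zero j h)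
    · have := isIso_of_mono_of_nonzero h
      exact extClosure_iso (asIso j).symm (extClosure_simple ha)
  · intro S hS h₁ h₃ Y j hj
    obtain ⟨K, I, f, g, w, a, b, h, ha, hb⟩ := shortExact_image_left hS j
    exact extClosure_ext h (h₁ _ a ha) (h₃ _ b hb)

lemma extClosure_epi (hL : ∀ a ∈ Ω, Simple (L a)) {X : C} (hX : extClosure L Ω X) :
    ∀ (Y : C) (q : X ⟶ Y), Epi q → extClosure L Ω Y := by
  refine hX (fun X => ∀ (Y : C) (q : X ⟶ Y), Epi q → extClosure L Ω Y) ?_ ?_ ?_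
  · intro X hX Y j hj
    exact extClosure_zero (hX.of_epi j)
  · intro a ha Y j hj
    have := hL a ha
    by_cases h : j = 0
    · exact extClosure_zero (IsZero.of_epi_eq_zero j h)
    · have := isIso_of_epi_of_nonzero h
      exact extClosure_iso (asIso j) (extClosure_simple ha)
  · intro S hS h₁ h₃ Y j hj
    obtain ⟨K, I, f, g, w, a, b, h, ha, hb⟩ := shortExact_image_right hS j
    exact extClosure_ext h (h₁ _ a ha) (h₃ _ b hb)

/-- Induction for objects of the Serre subcategory generated by a family of simple objects. -/
theorem serreSub_induction (hL : ∀ a ∈ Ω, Simple (L a)) {X : C} (hX : serreSub L Ω X)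
    (P : ObjectProperty C) (h0 : ∀ X, IsZero X → P X) (hs : ∀ a ∈ Ω, P (L a))
    (hext : ∀ S : ShortComplex C, S.ShortExact → serreSub L Ω S.X₁ → serreSub L Ω S.X₃ →
      P S.X₁ → P S.X₃ → P S.X₂) : P X := by
  have : (extClosure L Ω).IsSerreClass :=
    { exists_zero := ⟨_, isZero_zero C, extClosure_zero (isZero_zero C)⟩
      prop_of_mono := fun f _ h => extClosure_mono hL h _ f inferInstance
      prop_of_epi := fun f _ h => extClosure_epi hL h _ f inferInstance
      prop_X₂_of_shortExact := fun hS h₁ h₃ => extClosure_ext hS h₁ h₃ }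
  exact (hX _ this (fun a => extClosure_simple) (fun X => serreSub L Ω X ∧ P X)
    (fun X hX => ⟨ObjectProperty.prop_of_isZero _ hX, h0 X hX⟩)
    (fun a ha => ⟨serreSub_mem L ha, hs a ha⟩)
    (fun S hS h₁ h₃ => ⟨ObjectProperty.prop_X₂_of_shortExact _ hS h₁.1 h₃.1,
      hext S hS h₁.1 h₃.1 h₁.2 h₃.2⟩)).2

/-- The simple subobjects of an object of `C_Ω` are labelled by elements of `Ω`. -/
lemma serreSub_simple_mono (hL : ∀ a ∈ Ω, Simple (L a)) {X : C} (hX : serreSub L Ω X) :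
    ∀ (T : C) [Simple T] (t : T ⟶ X), t ≠ 0 → ∃ a ∈ Ω, Nonempty (T ≅ L a) := by
  refine serreSub_induction hL hX
    (fun X => ∀ (T : C) [Simple T] (t : T ⟶ X), t ≠ 0 → ∃ a ∈ Ω, Nonempty (T ≅ L a)) ?_ ?_ ?_
  · intro X hX T _ t ht
    exact (ht (hX.eq_of_tgt _ _)).elim
  · intro a ha T _ t ht
    have := hL a ha
    have := isIso_of_hom_simple ht
    exact ⟨a, ha, ⟨asIso t⟩⟩
  · intro S hS _ _ h₁ h₃ T _ t ht
    by_cases h : t ≫ S.g = 0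
    · obtain ⟨t', rfl⟩ := lift_of_shortExact hS t h
      exact h₁ T t' fun h' => ht (by rw [h', zero_comp])
    · exact h₃ T _ h

lemma IsSimpleLabelling.mem_of_serreSub (hL : IsSimpleLabelling L) {a : Λ}
    (h : serreSub L Ω (L a)) : a ∈ Ω := by
  have := hL.simple a
  obtain ⟨b, hb, ⟨e⟩⟩ := serreSub_simple_mono (fun a _ => hL.simple a) h (L a) (𝟙 _)
    (id_nonzero _)
  rwa [hL.injective a b ⟨e⟩]

/-- Every object lies in `C_Ω` for some finite set `Ω`. -/
lemma FiniteLength.exists_serreSub (h : FiniteLength C) (hL : IsSimpleLabelling L) (X : C) :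
    ∃ Ω : Set Λ, Ω.Finite ∧ serreSub L Ω X := by
  refine h.induction (fun X => ∃ Ω : Set Λ, Ω.Finite ∧ serreSub L Ω X) ?_ ?_ ?_ X
  · exact fun X hX => ⟨∅, Set.finite_empty, ObjectProperty.prop_of_isZero _ hX⟩
  · intro X hX
    obtain ⟨a, ⟨e⟩⟩ := hL.surjective X hX
    exact ⟨{a}, Set.finite_singleton a,
      (serreSub L {a}).prop_of_iso e.symm (serreSub_mem L rfl)⟩
  · rintro S hS ⟨Ω₁, h₁, h₁'⟩ ⟨Ω₃, h₃, h₃'⟩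
    exact ⟨Ω₁ ∪ Ω₃, h₁.union h₃, (serreSub L _).prop_X₂_of_shortExact hS
      (serreSub_mono L Set.subset_union_left _ h₁') (serreSub_mono L Set.subset_union_right _ h₃')⟩

end Serre

/-! ### Extension classes and long exact sequences -/

section Ext

open Abelian

variable {C : Type u} [Category.{v} C] [Abelian C] [HasExt.{w} C]

/-- Naturality of the class of an extension in its subobject and its quotient. -/
lemma extClass_eq_of_hom {S₁ S₂ : ShortComplex C} (h₁ : S₁.ShortExact) (h₂ : S₂.ShortExact)
    (a : S₁.X₁ ⟶ S₂.X₁) (b : S₁.X₂ ⟶ S₂.X₂) (c : S₁.X₃ ⟶ S₂.X₃) (hab : a ≫ S₂.f = S₁.f ≫ b)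
    (hbc : b ≫ S₂.g = S₁.g ≫ c) :
    h₁.extClass.comp (Ext.mk₀ a) (add_zero 1) = (Ext.mk₀ c).comp h₂.extClass (zero_add 1) :=
  ShortComplex.ShortExact.extClass_naturality h₁ h₂ ⟨a, b, c, hab, hbc⟩

/-- Every class in `Ext¹` is the class of an extension. -/
theorem exists_extClass_eq {X Y : C} (e : Ext X Y 1) :
    ∃ (E : C) (f : Y ⟶ E) (g : E ⟶ X) (w : f ≫ g = 0) (h : (ShortComplex.mk f g w).ShortExact),
      h.extClass = e := by
  -- As `e` dies on `X'`, it is the pushout, along some `φ`, of the extension of `X` by the kernel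
  -- of `p`.
  obtain ⟨X', p, hp, hpe⟩ := exists_epi_comp_eq_zero (n := 0) e
  have hS := shortExact_of_epi p
  obtain ⟨x, hx⟩ := Ext.contravariant_sequence_exact₃ hS Y e hpe (n₀ := 0) (by simp)
  obtain ⟨φ, rfl⟩ := Ext.addEquiv₀.symm.surjective x
  obtain ⟨E, f, g, w, u, h, hP, hu⟩ := exists_pushout_shortExact hS φ
  refine ⟨E, f, g, w, h, ?_⟩
  have := extClass_eq_of_hom hS h φ u (𝟙 X) hP.w.symm (hu.trans (Category.comp_id p).symm)
  rw [Ext.mk₀_id_comp] at this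
  rw [← this, ← hx]
  rfl

variable {S : ShortComplex C} (hS : S.ShortExact)

include hS

lemma ext_subsingleton_left₂ {Y : C} {n : ℕ} (h₁ : Subsingleton (Ext S.X₁ Y n))
    (h₃ : Subsingleton (Ext S.X₃ Y n)) : Subsingleton (Ext S.X₂ Y n) :=
  subsingleton_of_forall_eq 0 fun x => by
    obtain ⟨y, rfl⟩ := Ext.contravariant_sequence_exact₂ hS Y x (Subsingleton.elim _ _)
    rw [Subsingleton.elim y 0, Ext.comp_zero]

lemma ext_subsingleton_right₂ {X : C} {n : ℕ} (h₁ : Subsingleton (Ext X S.X₁ n))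
    (h₃ : Subsingleton (Ext X S.X₃ n)) : Subsingleton (Ext X S.X₂ n) :=
  subsingleton_of_forall_eq 0 fun x => by
    obtain ⟨y, rfl⟩ := Ext.covariant_sequence_exact₂ X hS x (Subsingleton.elim _ _)
    rw [Subsingleton.elim y 0, Ext.zero_comp]

lemma ext_subsingleton_left₃ {Y : C} {n : ℕ} (h₁ : Subsingleton (Ext S.X₁ Y n))
    (h₂ : Subsingleton (Ext S.X₂ Y (n + 1))) : Subsingleton (Ext S.X₃ Y (n + 1)) :=
  subsingleton_of_forall_eq 0 fun x => by
    obtain ⟨y, rfl⟩ := Ext.contravariant_sequence_exact₃ hS Y x (Subsingleton.elim _ _)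
      (add_comm 1 n)
    rw [Subsingleton.elim y 0, Ext.comp_zero]

lemma exists_hom_extension {Y : C} (h : Subsingleton (Ext S.X₃ Y 1)) (f : S.X₁ ⟶ Y) :
    ∃ g : S.X₂ ⟶ Y, S.f ≫ g = f := by
  obtain ⟨x, hx⟩ := Ext.contravariant_sequence_exact₁ hS Y (Ext.mk₀ f) (add_zero 1)
    (Subsingleton.elim _ _)
  obtain ⟨g, rfl⟩ := Ext.addEquiv₀.symm.surjective x
  refine ⟨g, Ext.addEquiv₀.symm.injective ?_⟩
  simpa using hx

lemma exists_hom_lift {X : C} (h : Subsingleton (Ext X S.X₁ 1)) (f : X ⟶ S.X₃) :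
    ∃ g : X ⟶ S.X₂, g ≫ S.g = f := by
  obtain ⟨x, hx⟩ := Ext.covariant_sequence_exact₃ X hS (Ext.mk₀ f) (zero_add 1)
    (Subsingleton.elim _ _)
  obtain ⟨g, rfl⟩ := Ext.addEquiv₀.symm.surjective x
  refine ⟨g, Ext.addEquiv₀.symm.injective ?_⟩
  simpa using hx

/-- Vanishing of `Ext¹` when all homomorphisms to the quotient lift. -/
lemma ext_one_subsingleton_of_lift {X : C} (h : Subsingleton (Ext X S.X₂ 1))
    (hl : ∀ f : X ⟶ S.X₃, ∃ g : X ⟶ S.X₂, g ≫ S.g = f) : Subsingleton (Ext X S.X₁ 1) :=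
  subsingleton_of_forall_eq 0 fun x => by
    obtain ⟨y, rfl⟩ := Ext.covariant_sequence_exact₁ X hS x (Subsingleton.elim _ _) (zero_add 1)
    obtain ⟨f, rfl⟩ := Ext.addEquiv₀.symm.surjective y
    obtain ⟨g, rfl⟩ := hl f
    have := (Ext.mk₀ g).comp_assoc (Ext.mk₀ S.g) hS.extClass (zero_add 0) (zero_add 1)
      (zero_add 1)
    simpa using this

lemma extClass_eq_zero_of_section (s : S.X₃ ⟶ S.X₂) (hs : s ≫ S.g = 𝟙 _) : hS.extClass = 0 := by
  rw [← Ext.mk₀_id_comp hS.extClass, ← hs, ← Ext.mk₀_comp_mk₀_assoc, hS.comp_extClass,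
    Ext.comp_zero]

lemma mk₀_comp_extClass_eq_zero_of_lift {X : C} (f : X ⟶ S.X₃) (s : X ⟶ S.X₂)
    (hs : s ≫ S.g = f) : (Ext.mk₀ f).comp hS.extClass (zero_add 1) = 0 := by
  rw [← hs, ← Ext.mk₀_comp_mk₀_assoc, hS.comp_extClass, Ext.comp_zero]

omit hS

lemma ext_one_subsingleton_of_split {X Y : C}
    (h : ∀ (E : C) (f : Y ⟶ E) (g : E ⟶ X) (w : f ≫ g = 0),
      (ShortComplex.mk f g w).ShortExact → ∃ s : X ⟶ E, s ≫ g = 𝟙 X) :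
    Subsingleton (Ext X Y 1) :=
  subsingleton_of_forall_eq 0 fun e => by
    obtain ⟨E, f, g, w, hS, rfl⟩ := exists_extClass_eq e
    obtain ⟨s, hs⟩ := h E f g w hS
    exact extClass_eq_zero_of_section hS s hs

lemma ext_subsingleton_of_isZero_left {X Y : C} (n : ℕ) (h : IsZero X) :
    Subsingleton (Ext X Y n) :=
  subsingleton_of_forall_eq 0 fun e => by
    rw [← Ext.mk₀_id_comp e, h.eq_of_src (𝟙 X) 0, Ext.mk₀_zero, Ext.zero_comp]

lemma ext_subsingleton_of_isZero_right {X Y : C} (n : ℕ) (h : IsZero Y) :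
    Subsingleton (Ext X Y n) :=
  subsingleton_of_forall_eq 0 fun e => by
    rw [← Ext.comp_mk₀_id e, h.eq_of_src (𝟙 Y) 0, Ext.mk₀_zero, Ext.comp_zero]

/-- If `Extⁿ(-, Y)` vanishes on the simple objects of `C_Ω`, then it vanishes on `C_Ω`. -/
lemma ext_subsingleton_of_serreSub_left {Λ : Type*} {L : Λ → C} {Ω : Set Λ}
    (hL : ∀ a ∈ Ω, Simple (L a)) {Y : C} {n : ℕ} (h : ∀ a ∈ Ω, Subsingleton (Ext (L a) Y n))
    {X : C} (hX : serreSub L Ω X) : Subsingleton (Ext X Y n) :=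
  serreSub_induction hL hX (fun X => Subsingleton (Ext X Y n))
    (fun _ => ext_subsingleton_of_isZero_left n) h
    (fun _ hS _ _ h₁ h₃ => ext_subsingleton_left₂ hS h₁ h₃)

lemma ext_subsingleton_of_serreSub_right {Λ : Type*} {L : Λ → C} {Ω : Set Λ}
    (hL : ∀ a ∈ Ω, Simple (L a)) {X : C} {n : ℕ} (h : ∀ a ∈ Ω, Subsingleton (Ext X (L a) n))
    {Y : C} (hY : serreSub L Ω Y) : Subsingleton (Ext X Y n) :=
  serreSub_induction hL hY (fun Y => Subsingleton (Ext X Y n))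
    (fun _ => ext_subsingleton_of_isZero_right n) h
    (fun _ hS _ _ h₁ h₃ => ext_subsingleton_right₂ hS h₁ h₃)

end Ext

/-! ### Injectivity and projectivity in truncations -/

section Trunc

open Abelian

variable {C : Type u} [Category.{v} C] [Abelian C] {Λ : Type*} {L : Λ → C} {Ω : Set Λ}

lemma trunc_mono_hom {X Y : Trunc L Ω} (f : X ⟶ Y) [Mono f] : Mono f.hom := by
  have := (serreSub L Ω).preservesMonomorphisms_ι_of_isNormalEpiCategory
  exact inferInstanceAs (Mono ((serreSub L Ω).ι.map f))

lemma trunc_epi_hom {X Y : Trunc L Ω} (f : X ⟶ Y) [Epi f] : Epi f.hom := by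
  have := (serreSub L Ω).preservesEpimorphisms_ι_of_isNormalMonoCategory
  exact inferInstanceAs (Epi ((serreSub L Ω).ι.map f))

lemma trunc_mono_of_hom {X Y : Trunc L Ω} (f : X ⟶ Y) (h : Mono f.hom) : Mono f :=
  (serreSub L Ω).ι.mono_of_mono_map h

lemma trunc_epi_of_hom {X Y : Trunc L Ω} (f : X ⟶ Y) (h : Epi f.hom) : Epi f :=
  (serreSub L Ω).ι.epi_of_epi_map h

variable [HasExt.{w} C]

/-- An object of `C_Ω` is injective if and only if `Ext¹` in `C` to it from `C_Ω` vanishes. -/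
theorem trunc_injective_iff (N : Trunc L Ω) :
    Injective N ↔ ∀ X, serreSub L Ω X → Subsingleton (Ext.{w} X N.obj 1) := by
  refine ⟨fun h X hX => ext_one_subsingleton_of_split fun E f g w hS => ?_, fun h => ⟨?_⟩⟩
  -- The middle term of the extension stays in `C_Ω`, so injectivity there splits it.
  · have hE : serreSub L Ω E := (serreSub L Ω).prop_X₂_of_shortExact hS N.property hX
    let f' : N ⟶ (⟨E, hE⟩ : Trunc L Ω) := ObjectProperty.homMk f
    have : Mono f' := trunc_mono_of_hom f' hS.mono_f
    let r := Injective.factorThru (𝟙 N) f'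
    have hr : f ≫ r.hom = 𝟙 _ := congrArg (·.hom) (Injective.comp_factorThru (𝟙 N) f')
    let s := ShortComplex.Splitting.ofExactOfRetraction _ hS.exact r.hom hr hS.epi_g
    exact ⟨s.s, s.s_g⟩
  · intro X Y g f hf
    have := trunc_mono_hom f
    have hS := shortExact_of_mono f.hom
    obtain ⟨k, hk⟩ := exists_hom_extension hS (h _ ((serreSub L Ω).prop_X₃_of_shortExact hS
      Y.property)) g.hom
    exact ⟨ObjectProperty.homMk k, by ext; exact hk⟩

/-- An object of `C_Ω` is projective if and only if `Ext¹` in `C` from it to `C_Ω` vanishes. -/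
theorem trunc_projective_iff (N : Trunc L Ω) :
    Projective N ↔ ∀ X, serreSub L Ω X → Subsingleton (Ext.{w} N.obj X 1) := by
  refine ⟨fun h X hX => ext_one_subsingleton_of_split fun E f g w hS => ?_, fun h => ⟨?_⟩⟩
  · have hE : serreSub L Ω E := (serreSub L Ω).prop_X₂_of_shortExact hS hX N.property
    let g' : (⟨E, hE⟩ : Trunc L Ω) ⟶ N := ObjectProperty.homMk g
    have : Epi g' := trunc_epi_of_hom g' hS.epi_g
    exact ⟨(Projective.factorThru (𝟙 N) g').hom,
      congrArg (·.hom) (Projective.factorThru_comp (𝟙 N) g')⟩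
  · intro X Y g f hf
    have := trunc_epi_hom f
    have hS := shortExact_of_epi f.hom
    obtain ⟨k, hk⟩ := exists_hom_lift hS (h _ ((serreSub L Ω).prop_X₁_of_shortExact hS
      X.property)) g.hom
    exact ⟨ObjectProperty.homMk k, by ext; exact hk⟩

end Trunc

/-! ### Objects with filtrations -/

section Filtrations

variable {C : Type u} [Category.{v} C] [Abelian C]

lemma HasFiltration.of_iso {l : List C} {X Y : C} (h : HasFiltration l X) (e : X ≅ Y) :
    HasFiltration l Y := by
  cases h with
  | nil hX => exact .nil (hX.of_iso e.symm)
  | @cons l S hS h =>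
    have hS' : (ShortComplex.mk (S.f ≫ e.hom) (e.inv ≫ S.g) (by simp)).ShortExact :=
      ShortComplex.shortExact_of_iso
        (ShortComplex.isoMk (S₁ := S) (S₂ := .mk (S.f ≫ e.hom) (e.inv ≫ S.g) (by simp))
          (Iso.refl _) e (Iso.refl _) (by simp) (by simp)) hS
    exact .cons hS' h

lemma HasFiltration.cons' {l : List C} {X₁ X₂ X₃ : C} {f : X₁ ⟶ X₂} {g : X₂ ⟶ X₃} {w : f ≫ g = 0}
    (hS : (ShortComplex.mk f g w).ShortExact) (h : HasFiltration l X₁) :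
    HasFiltration (X₃ :: l) X₂ :=
  .cons hS h

/-- The filtration of the quotient is pulled back to `X₂`, one step at a time. -/
lemma HasFiltration.append {l₁ l₃ : List C} {X₁ X₂ X₃ : C} {f : X₁ ⟶ X₂} {g : X₂ ⟶ X₃}
    {w : f ≫ g = 0} (hS : (ShortComplex.mk f g w).ShortExact)
    (h₁ : HasFiltration l₁ X₁) (h₃ : HasFiltration l₃ X₃) : HasFiltration (l₃ ++ l₁) X₂ := by
  induction h₃ generalizing X₂ with
  | nil hX =>
    have : IsIso f := hS.isIso_f_iff.2 hX
    exact h₁.of_iso (asIso f)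
  | @cons l T hT h ih =>
    obtain ⟨E, f', g', w₁, j, w₂, h', h'', -⟩ := exists_shortExact_preimage hS
      (w := T.zero) hT
    exact .cons' h'' (ih h')

variable {Λ : Type*} (nabla : Λ → C) (B : Set Λ)

/-- `X` has a finite filtration with all quotients isomorphic to some `nabla b` for `b ∈ B`. -/
def IsFiltered (X : C) : Prop :=
  ∃ l : List C, HasFiltration l X ∧ ∀ Q ∈ l, ∃ b, b ∈ B ∧ Nonempty (Q ≅ nabla b)

variable {nabla B}

lemma IsFiltered.zero {X : C} (hX : IsZero X) : IsFiltered nabla B X := ⟨[], .nil hX, by simp⟩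

lemma IsFiltered.cons {S : ShortComplex C} (hS : S.ShortExact) (h : IsFiltered nabla B S.X₁)
    {b : Λ} (hb : b ∈ B) (e : S.X₃ ≅ nabla b) : IsFiltered nabla B S.X₂ := by
  obtain ⟨l, hl, h⟩ := h
  refine ⟨_, .cons hS hl, fun Q hQ => ?_⟩
  rcases List.mem_cons.1 hQ with rfl | hQ
  · exact ⟨b, hb, ⟨e⟩⟩
  · exact h Q hQ

lemma IsFiltered.ext {S : ShortComplex C} (hS : S.ShortExact) (h₁ : IsFiltered nabla B S.X₁)
    (h₃ : IsFiltered nabla B S.X₃) : IsFiltered nabla B S.X₂ := by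
  obtain ⟨l₁, hl₁, h₁⟩ := h₁
  obtain ⟨l₃, hl₃, h₃⟩ := h₃
  refine ⟨_, hl₁.append hS hl₃, fun Q hQ => ?_⟩
  rcases List.mem_append.1 hQ with hQ | hQ
  · exact h₃ Q hQ
  · exact h₁ Q hQ

lemma IsFiltered.of_mem {X : C} {b : Λ} (hb : b ∈ B) (e : X ≅ nabla b) : IsFiltered nabla B X :=
  .cons (shortExact_of_epi (𝟙 X)) (.zero (isZero_kernel_of_mono _)) hb e

/-- Induction on objects filtered by the `nabla b`. -/
theorem IsFiltered.induction {X : C} (hX : IsFiltered nabla B X) (P : ObjectProperty C)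
    (h0 : ∀ X, IsZero X → P X) (hext : ∀ S : ShortComplex C, S.ShortExact →
      IsFiltered nabla B S.X₁ → P S.X₁ → ∀ b ∈ B, (S.X₃ ≅ nabla b) → P S.X₂) : P X := by
  obtain ⟨l, hl, h⟩ := hX
  induction hl with
  | nil hX => exact h0 _ hX
  | @cons l S hS hl ih =>
    obtain ⟨b, hb, ⟨e⟩⟩ := h S.X₃ (by simp)
    have h' : ∀ Q ∈ l, ∃ b, b ∈ B ∧ Nonempty (Q ≅ nabla b) :=
      fun Q hQ => h Q (List.mem_cons_of_mem _ hQ)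
    exact hext S hS ⟨l, hl, h'⟩ (ih h') b hb e

lemma serreSub.isFiltered {L : Λ → C} (hL : ∀ a ∈ B, Simple (L a)) {X : C}
    (hX : serreSub L B X) : IsFiltered L B X :=
  serreSub_induction hL hX (IsFiltered L B) (fun _ => .zero)
    (fun _ ha => .of_mem ha (Iso.refl _)) (fun _ hS _ _ h₁ h₃ => .ext hS h₁ h₃)

end Filtrations

/-! ### Jordan–Hölder multiplicities -/

section Multiplicity

variable {C : Type u} [Category.{v} C] [Abelian C]

open Classical in
/-- Removing a simple subobject from a composition series. -/
lemma HasFiltration.quotient {l : List C} {X : C} (h : HasFiltration l X)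
    (hl : ∀ T ∈ l, Simple T) {S : C} [Simple S] (s : S ⟶ X) (hs : s ≠ 0) :
    ∃ (Q : C) (q : X ⟶ Q) (w : s ≫ q = 0) (l' : List C), (ShortComplex.mk s q w).ShortExact ∧
      HasFiltration l' Q ∧ (∀ T ∈ l', Simple T) ∧
      l'.countP (fun T => decide (Nonempty (T ≅ S))) + 1 =
        l.countP (fun T => decide (Nonempty (T ≅ S))) := by
  induction h with
  | nil hX => exact (hs (hX.eq_of_tgt _ _)).elim
  | @cons l R hR h ih =>
    have hT : ∀ T ∈ l, Simple T := fun T hT => hl T (List.mem_cons_of_mem _ hT)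
    have := hl R.X₃ (by simp)
    have hs' : Mono s := mono_of_nonzero_from_simple hs
    -- Either `S` lies in the next term of the filtration, and induction applies, or it maps
    -- isomorphically onto the top factor; then it is a complement of `R.X₁`, which serves as the
    -- quotient.
    by_cases hz : s ≫ R.g = 0
    · obtain ⟨s', rfl⟩ := lift_of_shortExact hR s hz
      obtain ⟨Q, q, w, l', hQ, hl', hl'', hc⟩ := ih hT s' fun h0 => hs (by rw [h0, zero_comp])
      obtain ⟨E, f, g, w₁, q', w₂, h₁, h₂, -⟩ := exists_shortExact_quotient hR hQ
      refine ⟨E, q', w₂, _, h₂, .cons' h₁ hl', ?_, ?_⟩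
      · intro T hT
        rcases List.mem_cons.1 hT with rfl | hT
        · exact this
        · exact hl'' T hT
      · rw [List.countP_cons, List.countP_cons, ← hc]
        ring
    · have hi : IsIso (s ≫ R.g) := isIso_of_hom_simple hz
      have := hR.mono_f
      let p := ShortComplex.Splitting.ofExactOfSection R hR.exact (inv (s ≫ R.g) ≫ s) (by simp)
        hR.mono_f
      have hp : s ≫ p.r = 0 := by
        have : (inv (s ≫ R.g) ≫ s) ≫ p.r = 0 := p.s_r
        rwa [Category.assoc, IsIso.inv_comp_eq, comp_zero] at this
      refine ⟨R.X₁, p.r, hp, l, ?_, h, hT, ?_⟩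
      · refine { exact := ?_, mono_f := hs', epi_g := (SplitEpi.mk _ p.f_r).epi }
        apply ShortComplex.exact_of_f_is_kernel
        refine KernelFork.IsLimit.ofι' _ _ fun {W} k hk => ⟨k ≫ R.g ≫ inv (s ≫ R.g), ?_⟩
        dsimp at hk
        have h1 : k ≫ p.r ≫ R.f + k ≫ R.g ≫ (inv (s ≫ R.g) ≫ s) = k := by
          rw [← Preadditive.comp_add]
          exact (congrArg (k ≫ ·) p.id).trans (Category.comp_id k)
        rw [← Category.assoc k p.r, hk, zero_comp, zero_add] at h1
        simpa using h1
      · rw [List.countP_cons_of_pos]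
        simpa using ⟨(asIso (s ≫ R.g)).symm⟩

variable {Λ : Type*} [PartialOrder Λ] {L : Λ → C}

/-- If `[X : L a] = 1` for an object `X` of `C_{≤ a}` and `L a` is a subobject of `X`, then the
quotient lies in `C_{< a}`. -/
lemma serreSub_quotient_of_hasMultiplicity (hL : IsSimpleLabelling L) {S : ShortComplex C}
    (hS : S.ShortExact) {a : Λ} (e : S.X₁ ≅ L a) (hX : serreSub L (Set.Iic a) S.X₂)
    (hm : HasMultiplicity S.X₂ (L a) 1) : serreSub L (Set.Iio a) S.X₃ := by
  classical
  obtain ⟨l, hl, hl', hc⟩ := hm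
  have := hL.simple a
  have := hS.mono_f
  have hs : e.inv ≫ S.f ≠ 0 := by
    intro h
    rw [← cancel_epi e.hom, comp_zero, Iso.hom_inv_id_assoc] at h
    have h' : 𝟙 S.X₁ = 0 := by rw [← cancel_mono S.f, h, comp_zero, comp_zero]
    exact id_nonzero (L a) (by rw [← e.inv_hom_id, ← Category.id_comp e.hom, h', zero_comp,
      comp_zero])
  obtain ⟨Q, q, w, l', hQ, hlQ, hl'', hc'⟩ := hl.quotient hl' (e.inv ≫ S.f) hs
  have hQ' : serreSub L (Set.Iic a) Q := (serreSub L _).prop_X₃_of_shortExact hQ hX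
  have hc'' : l'.countP (fun T => decide (Nonempty (T ≅ L a))) = 0 := by
    have := hc'.trans ((by congr!) : _ = _) |>.trans hc
    omega
  rw [List.countP_eq_zero] at hc''
  have key : serreSub L (Set.Iio a) Q := by
    clear hQ w q hc' hl hl' hc hs
    induction hlQ with
    | nil hX => exact (serreSub L _).prop_of_isZero hX
    | @cons l R hR h ih =>
      have h₃ := hl'' R.X₃ (by simp)
      obtain ⟨b, hb, ⟨e'⟩⟩ := serreSub_simple_mono (fun a _ => hL.simple a)
        ((serreSub L _).prop_X₃_of_shortExact hR hQ') R.X₃ (𝟙 _) (id_nonzero _)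
      refine (serreSub L _).prop_X₂_of_shortExact hR
        (ih (fun T hT => hl'' T (List.mem_cons_of_mem _ hT))
          ((serreSub L _).prop_X₁_of_shortExact hR hQ')
          (fun T hT => hc'' T (List.mem_cons_of_mem _ hT)))
        ((serreSub L _).prop_of_iso e'.symm (serreSub_mem L (lt_of_le_of_ne hb ?_)))
      rintro rfl
      exact hc'' R.X₃ (by simp) (by simpa using ⟨e'⟩)
  have := hS.epi_g
  obtain ⟨t, ht⟩ := desc_of_shortExact hQ S.g (by rw [Category.assoc, S.zero, comp_zero])
  have : Epi t := by
    have : Epi (q ≫ t) := by rw [show q ≫ t = S.g from ht]; exact hS.epi_g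
    exact epi_of_epi q t
  exact (serreSub L _).prop_of_epi t key

/-- If `X` is an extension of `L a` by an object of `C_{< a}`, then `[X : L a] = 1`. -/
lemma hasMultiplicity_one (hL : IsSimpleLabelling L) {S : ShortComplex C}
    (hS : S.ShortExact) {a : Λ} (e : S.X₃ ≅ L a) (hX : serreSub L (Set.Iio a) S.X₁) :
    HasMultiplicity S.X₂ (L a) 1 := by
  classical
  obtain ⟨l, hl, h⟩ := hX.isFiltered (fun a _ => hL.simple a)
  have := hL.simple a
  refine ⟨_, .cons hS hl, fun T hT => ?_, ?_⟩
  · rcases List.mem_cons.1 hT with rfl | hT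
    · exact Simple.of_iso e
    · obtain ⟨b, -, ⟨e⟩⟩ := h T hT
      have := hL.simple b
      exact Simple.of_iso e
  · rw [List.countP_cons_of_pos (by simpa using ⟨e⟩), Nat.add_eq_right, List.countP_eq_zero]
    intro T hT hT'
    obtain ⟨b, hb, ⟨e⟩⟩ := h T hT
    simp only [decide_eq_true_eq] at hT'
    obtain ⟨e'⟩ := hT'
    exact (ne_of_lt (Set.mem_Iio.1 hb)) (hL.injective b a ⟨e.symm ≪≫ e'⟩)

end Multiplicity

/-! ### Simple socles and simple tops -/

section Essential

variable {C : Type u} [Category.{v} C] [Abelian C]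

/-- An essential monomorphism from a simple object factors through each nonzero subobject. -/
lemma exists_factor_of_essential {S N : C} (i : S ⟶ N)
    (hi : ∀ ⦃Z : C⦄ (g : N ⟶ Z), i ≫ g ≠ 0 → Mono g) {M : C} (f : M ⟶ N) (hf : f ≠ 0) [Mono f] :
    ∃ u : S ⟶ M, u ≫ f = i := by
  by_cases h : i ≫ cokernel.π f = 0
  · exact lift_of_shortExact (shortExact_of_mono f) i h
  · have := hi _ h
    exact (hf (by rw [← cancel_mono (cokernel.π f), cokernel.condition, zero_comp])).elim

lemma exists_factor_of_superfluous {S N : C} (p : N ⟶ S)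
    (hp : ∀ ⦃Z : C⦄ (g : Z ⟶ N), g ≫ p ≠ 0 → Epi g) {M : C} (f : N ⟶ M) (hf : f ≠ 0) [Epi f] :
    ∃ u : M ⟶ S, f ≫ u = p := by
  by_cases h : kernel.ι f ≫ p = 0
  · exact desc_of_shortExact (shortExact_of_epi f) p h
  · have := hp _ h
    exact (hf (by rw [← cancel_epi (kernel.ι f), kernel.condition, comp_zero])).elim

variable {Λ : Type*} {L : Λ → C} {Ω : Set Λ}

/-- By essentiality the image of a nonzero morphism would contain `L a`. -/
lemma hom_eq_zero_of_essential (hL : IsSimpleLabelling L) {a : Λ} {N : C} (i : L a ⟶ N)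
    (hm : Mono i) (hi : ∀ ⦃Z : C⦄ (g : N ⟶ Z), i ≫ g ≠ 0 → Mono g) (ha : a ∉ Ω) {X : C}
    (hX : serreSub L Ω X) (f : X ⟶ N) : f = 0 := by
  by_contra hf
  obtain ⟨u, hu⟩ := exists_factor_of_essential i hi (Abelian.image.ι f)
    (fun h => hf (by rw [← Abelian.image.fac f, h, comp_zero]))
  have : Mono (u ≫ Abelian.image.ι f) := by rwa [hu]
  have : Mono u := mono_of_mono u (Abelian.image.ι f)
  exact ha (hL.mem_of_serreSub ((serreSub L Ω).prop_of_mono u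
    ((serreSub L Ω).prop_of_epi (Abelian.factorThruImage f) hX)))

/-- The image of `g` is again in `C_Ω`, so essentiality within `C_Ω` already decides the matter in
`C`. -/
lemma IsInjectiveHull.essential_hom (hL : IsSimpleLabelling L) {a : Λ} {ha : a ∈ Ω}
    {N : Trunc L Ω} {i : truncSimple L ha ⟶ N} (h : IsInjectiveHull i) ⦃Z : C⦄ (g : N.obj ⟶ Z)
    (hg : i.hom ≫ g ≠ 0) : Mono g := by
  have := hL.simple a
  let I : Trunc L Ω := ⟨Abelian.image g,
    (serreSub L Ω).prop_of_epi (Abelian.factorThruImage g) N.property⟩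
  let g' : N ⟶ I := ObjectProperty.homMk (Abelian.factorThruImage g)
  have h1 : i.hom ≫ Abelian.factorThruImage g ≠ 0 := fun h0 => hg (by
    rw [← Abelian.image.fac g, ← Category.assoc, h0, zero_comp])
  have h2 : Mono (i.hom ≫ Abelian.factorThruImage g) := mono_of_nonzero_from_simple h1
  have h3 : Mono g' := h.essential g' (trunc_mono_of_hom _ h2)
  have h4 : Mono (Abelian.factorThruImage g) := trunc_mono_hom g'
  rw [← Abelian.image.fac g]
  exact mono_comp _ _

lemma IsProjectiveCover.superfluous_hom (hL : IsSimpleLabelling L) {a : Λ} {ha : a ∈ Ω}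
    {N : Trunc L Ω} {p : N ⟶ truncSimple L ha} (h : IsProjectiveCover p) ⦃Z : C⦄ (g : Z ⟶ N.obj)
    (hg : g ≫ p.hom ≠ 0) : Epi g := by
  have := hL.simple a
  let I : Trunc L Ω := ⟨Abelian.image g,
    (serreSub L Ω).prop_of_mono (Abelian.image.ι g) N.property⟩
  let g' : I ⟶ N := ObjectProperty.homMk (Abelian.image.ι g)
  have h1 : Abelian.image.ι g ≫ p.hom ≠ 0 := fun h0 => hg (by
    rw [← Abelian.image.fac g, Category.assoc, h0, comp_zero])
  have h2 : Epi (Abelian.image.ι g ≫ p.hom) := epi_of_nonzero_to_simple h1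
  have h3 : Epi g' := h.superfluous g' (trunc_epi_of_hom _ h2)
  have h4 : Epi (Abelian.image.ι g) := trunc_epi_hom g'
  rw [← Abelian.image.fac g]
  exact epi_comp _ _

lemma isInjectiveHull_of_essential (hL : IsSimpleLabelling L) {a : Λ} {ha : a ∈ Ω}
    {N : Trunc L Ω} (i : truncSimple L ha ⟶ N) (hi : Mono i.hom) (hN : Injective N)
    (h : ∀ ⦃Z : C⦄ (g : N.obj ⟶ Z), i.hom ≫ g ≠ 0 → Mono g) : IsInjectiveHull i where
  mono := trunc_mono_of_hom i hi
  injective := hN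
  essential Z g hg := by
    have := hL.simple a
    have hg' : Mono (i ≫ g).hom := trunc_mono_hom _
    refine trunc_mono_of_hom g (h g.hom fun h0 => id_nonzero (L a) ?_)
    have h1 : (i ≫ g).hom = 0 := h0
    exact (cancel_mono (i ≫ g).hom).1 (by rw [h1, comp_zero, comp_zero])

end Essential

/-! ### Standard and costandard objects -/

section Systems

open Abelian

variable {C : Type u} [Category.{v} C] [Abelian C] [HasExt.{w} C] {Λ : Type*} [PartialOrder Λ]
  (L : Λ → C)

/-- The defining properties of costandard objects, in terms of the category `C`. -/
structure IsCostandard (nabla : Λ → C) (i : ∀ a, L a ⟶ nabla a) : Prop where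
  mem : ∀ a, serreSub L (Set.Iic a) (nabla a)
  mono : ∀ a, Mono (i a)
  essential : ∀ a ⦃Z : C⦄ (g : nabla a ⟶ Z), i a ≫ g ≠ 0 → Mono g
  ext_one : ∀ a Ω, IsLowerSet Ω → Ω.Finite → Maximal (· ∈ Ω) a → ∀ X, serreSub L Ω X →
    Subsingleton (Ext.{w} X (nabla a) 1)

/-- The defining properties of standard objects, in terms of the category `C`. -/
structure IsStandard (delta : Λ → C) (p : ∀ a, delta a ⟶ L a) : Prop where
  mem : ∀ a, serreSub L (Set.Iic a) (delta a)
  epi : ∀ a, Epi (p a)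
  superfluous : ∀ a ⦃Z : C⦄ (g : Z ⟶ delta a), g ≫ p a ≠ 0 → Epi g
  ext_one : ∀ a X, serreSub L (Set.Iic a) X → Subsingleton (Ext.{w} (delta a) X 1)

variable {L} (hL : IsSimpleLabelling L) {nabla delta : Λ → C} {i : ∀ a, L a ⟶ nabla a}
  {p : ∀ a, delta a ⟶ L a}

include hL

lemma IsCostandard.i_ne_zero (hN : IsCostandard.{w} L nabla i) (a : Λ) : i a ≠ 0 := by
  have := hL.simple a
  have := hN.mono a
  intro h
  exact id_nonzero (L a) (by rw [← cancel_mono (i a), h, comp_zero, comp_zero])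

lemma IsStandard.p_ne_zero (hD : IsStandard.{w} L delta p) (a : Λ) : p a ≠ 0 := by
  have := hL.simple a
  have := hD.epi a
  intro h
  exact id_nonzero (L a) (by rw [← cancel_epi (p a), h, zero_comp, zero_comp])

lemma IsCostandard.hom_eq_zero (hN : IsCostandard.{w} L nabla i) {Ω : Set Λ} {a : Λ}
    (ha : a ∉ Ω) {X : C} (hX : serreSub L Ω X) (f : X ⟶ nabla a) : f = 0 :=
  hom_eq_zero_of_essential hL (i a) (hN.mono a) (hN.essential a) ha hX f

lemma IsStandard.hom_eq_zero (hD : IsStandard.{w} L delta p) {Ω : Set Λ} {a : Λ}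
    (ha : a ∉ Ω) {X : C} (hX : serreSub L Ω X) (f : delta a ⟶ X) : f = 0 := by
  by_contra hf
  obtain ⟨u, hu⟩ := exists_factor_of_superfluous (p a) (hD.superfluous a)
    (Abelian.factorThruImage f) (fun h => hf (by rw [← Abelian.image.fac f, h, zero_comp]))
  have : Epi u := by
    have : Epi (Abelian.factorThruImage f ≫ u) := by rw [hu]; exact hD.epi a
    exact epi_of_epi (Abelian.factorThruImage f) u
  exact ha (hL.mem_of_serreSub ((serreSub L Ω).prop_of_epi u
    ((serreSub L Ω).prop_of_mono (Abelian.image.ι f) hX)))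

/-- A nonzero morphism from a simple object to a costandard object identifies it with the socle. -/
lemma IsCostandard.exists_iso_of_simple (hN : IsCostandard.{w} L nabla i) {a : Λ} {T : C}
    [Simple T] (t : T ⟶ nabla a) (ht : t ≠ 0) : ∃ e : L a ≅ T, e.hom ≫ t = i a := by
  have := hL.simple a
  have : Mono t := mono_of_nonzero_from_simple ht
  obtain ⟨u, hu⟩ := exists_factor_of_essential (i a) (hN.essential a) t ht
  have hu0 : u ≠ 0 := fun h => hN.i_ne_zero hL a (by rw [← hu, h, zero_comp])
  have := isIso_of_hom_simple hu0
  exact ⟨asIso u, hu⟩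

omit hL

/-- Supplies the finite ideal in which ∇(b) is injective and which also accommodates objects of
`C_{≤ a}`. -/
lemma maximal_union_Iic {a b : Λ} (h : ¬ b < a) :
    Maximal (· ∈ Set.Iic a ∪ Set.Iic b) b := by
  refine ⟨Or.inr le_rfl, fun c hc hbc => ?_⟩
  rcases hc with hc | hc
  · have hba : b = a := (le_trans hbc hc).eq_of_not_lt h
    subst hba
    exact hc
  · exact hc

variable (hΛ : ∀ a : Λ, (Set.Iic a).Finite)

include hΛ in
/-- `Ext¹` between standard and costandard objects vanishes. -/
lemma ext_one_standard_costandard (hN : IsCostandard.{w} L nabla i)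
    (hD : IsStandard.{w} L delta p) (a b : Λ) :
    Subsingleton (Ext.{w} (delta a) (nabla b) 1) := by
  -- If `b < a`, then ∇(b) lies in `C_{≤ a}`, where Δ(a) is projective. Otherwise `b` is maximal in
  -- the ideal generated by `a` and `b`, where ∇(b) is injective.
  by_cases h : b < a
  · exact hD.ext_one a _ (serreSub_mono L (Set.Iic_subset_Iic.2 h.le) _ (hN.mem b))
  · exact hN.ext_one b _ ((isLowerSet_Iic a).union (isLowerSet_Iic b)) ((hΛ a).union (hΛ b))
      (maximal_union_Iic h) _ (serreSub_mono L Set.subset_union_left _ (hD.mem a))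

include hΛ in
lemma ext_one_costandard_costandard (hN : IsCostandard.{w} L nabla i) {a b : Λ} (h : ¬ b < a) :
    Subsingleton (Ext.{w} (nabla a) (nabla b) 1) :=
  hN.ext_one b _ ((isLowerSet_Iic a).union (isLowerSet_Iic b)) ((hΛ a).union (hΛ b))
      (maximal_union_Iic h) _ (serreSub_mono L Set.subset_union_left _ (hN.mem a))

omit [PartialOrder Λ] in
lemma ext_subsingleton_of_isFiltered {B : Set Λ} {X Y : C} {n : ℕ} (hY : IsFiltered nabla B Y)
    (h : ∀ b ∈ B, Subsingleton (Ext.{w} X (nabla b) n)) : Subsingleton (Ext.{w} X Y n) := by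
  have h0 : ∀ Z : C, IsZero Z → Subsingleton (Ext.{w} X Z n) :=
    fun _ => ext_subsingleton_of_isZero_right n
  refine hY.induction (fun Y => Subsingleton (Ext.{w} X Y n)) h0 fun S hS _ h₁ b hb e => ?_
  exact ext_subsingleton_right₂ hS h₁ (prop_of_iso_of_ext
    (P := fun Y => Subsingleton (Ext.{w} X Y n)) h0
    (fun _ hS => ext_subsingleton_right₂ hS) e.symm (h b hb))

include hL

/-- The kernel of `Δ(a) ⟶ L(a)` lies in `C_{< a}`. -/
lemma IsStandard.kernel_mem (hN : IsCostandard.{w} L nabla i) (hD : IsStandard.{w} L delta p)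
    (hm : ∀ a, HasMultiplicity (nabla a) (L a) 1) (hΛ : ∀ a : Λ, (Set.Iic a).Finite) (a : Λ) :
    serreSub L (Set.Iio a) (kernel (p a)) := by
  have := hL.simple a
  have := hN.mono a
  have := hD.epi a
  have hmax : Maximal (· ∈ Set.Iic a) a := ⟨le_rfl, fun _ h _ => h⟩
  have hext : ∀ X, serreSub L (Set.Iic a) X → Subsingleton (Ext.{w} X (nabla a) 1) :=
    hN.ext_one a _ (isLowerSet_Iic a) (hΛ a) hmax
  have hQ := serreSub_quotient_of_hasMultiplicity hL (shortExact_of_mono (i a)) (Iso.refl _)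
    (hN.mem a) (hm a)
  have hR : serreSub L (Set.Iic a) (kernel (p a)) :=
    (serreSub L _).prop_of_mono (kernel.ι (p a)) (hD.mem a)
  -- Such an `f` extends to Δ(a) by injectivity. The extension vanishes modulo the socle, as
  -- ∇(a)/L(a) lies in `C_{< a}`; so it factors through the top L(a), and its restriction to the
  -- kernel is zero.
  have hzero : ∀ f : kernel (p a) ⟶ nabla a, f = 0 := by
    intro f
    obtain ⟨g, hg⟩ := exists_hom_extension (shortExact_of_epi (p a))
      (hext _ (serreSub_mem L le_rfl)) f
    dsimp at hg
    have hg' : g ≫ cokernel.π (i a) = 0 :=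
      hD.hom_eq_zero hL (by simp : a ∉ Set.Iio a) hQ _
    obtain ⟨g', rfl⟩ := lift_of_shortExact (shortExact_of_mono (i a)) g hg'
    dsimp at g' hg
    by_cases h0 : kernel.ι (p a) ≫ g' = 0
    · rw [← hg, ← Category.assoc, h0, zero_comp]
    · have : g' ≠ 0 := fun h => h0 (by rw [h, comp_zero])
      have hep : Epi g' := epi_of_nonzero_to_simple this
      obtain ⟨u, hu⟩ := exists_factor_of_superfluous (p a) (hD.superfluous a) g' this
      have hu0 : u ≠ 0 := fun h => hD.p_ne_zero hL a (by rw [← hu, h, comp_zero])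
      have := isIso_of_hom_simple hu0
      refine (h0 ?_).elim
      rw [← cancel_mono u, Category.assoc, hu, kernel.condition, zero_comp]
  -- As ∇(a) is injective in `C_{≤ a}`, the absence of maps to it passes to subobjects and
  -- quotients, and thereby excludes L(a) as a composition factor.
  have key : ∀ X, serreSub L (Set.Iic a) X → (∀ f : X ⟶ nabla a, f = 0) →
      serreSub L (Set.Iio a) X := by
    intro X hX
    refine serreSub_induction (fun a _ => hL.simple a) hX
      (fun X => (∀ f : X ⟶ nabla a, f = 0) → serreSub L (Set.Iio a) X) ?_ ?_ ?_
    · exact fun X hX _ => (serreSub L _).prop_of_isZero hX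
    · intro b hb h
      refine serreSub_mem L (lt_of_le_of_ne hb ?_)
      rintro rfl
      exact hN.i_ne_zero hL b (h (i b))
    · intro S hS _ h₃ h₁ h₃' h
      have := hS.epi_g
      refine (serreSub L _).prop_X₂_of_shortExact hS (h₁ fun f => ?_) (h₃' fun f => ?_)
      · obtain ⟨g, rfl⟩ := exists_hom_extension hS (hext _ h₃) f
        rw [h g, comp_zero]
      · rw [← cancel_epi S.g, h (S.g ≫ f), comp_zero]
  exact key _ hR hzero

/-- `Δ(a)` is projective in `C_Ω` whenever `a` is maximal in `Ω`. -/
lemma IsStandard.ext_one_of_maximal (hN : IsCostandard.{w} L nabla i)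
    (hD : IsStandard.{w} L delta p) (hm : ∀ a, HasMultiplicity (nabla a) (L a) 1)
    (hΛ : ∀ a : Λ, (Set.Iic a).Finite) {Ω : Set Λ} {a : Λ} (ha : Maximal (· ∈ Ω) a) {X : C}
    (hX : serreSub L Ω X) : Subsingleton (Ext.{w} (delta a) X 1) := by
  refine ext_subsingleton_of_serreSub_right (fun a _ => hL.simple a) (fun b hb => ?_) hX
  have := hN.mono b
  have hS := shortExact_of_mono (i b)
  have hQ := serreSub_quotient_of_hasMultiplicity hL hS (Iso.refl _) (hN.mem b) (hm b)
  -- Any morphism Δ(a) → ∇(b)/L(b) is zero, since `a < b` is impossible; so it lifts trivially.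
  refine ext_one_subsingleton_of_lift hS (ext_one_standard_costandard hΛ hN hD a b) fun f =>
    ⟨0, ?_⟩
  rw [zero_comp]
  refine (hD.hom_eq_zero hL (Ω := Set.Iio b) (fun h => ?_) hQ f).symm
  exact absurd (ha.2 hb (le_of_lt h)) (not_le_of_gt h)

end Systems

/-! ### Injective hulls in truncations, built from costandard objects -/

section Hulls

open Abelian

variable {C : Type u} [Category.{v} C] [Abelian C] [HasExt.{w} C] {Λ : Type*} [PartialOrder Λ]

/-- `j : L a ⟶ J` is an essential monomorphism to an object of `C_Ω'` which is filtered by the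
`nabla b` with `b ≥ a`, and `Ext¹` from `C_Ω` to `J` vanishes. -/
structure IsPartialHull (L nabla : Λ → C) (Ω Ω' : Set Λ) {a : Λ} {J : C} (j : L a ⟶ J) :
    Prop where
  mem : serreSub L Ω' J
  mono : Mono j
  essential : ∀ ⦃Z : C⦄ (g : J ⟶ Z), j ≫ g ≠ 0 → Mono g
  ext_one : ∀ X, serreSub L Ω X → Subsingleton (Ext.{w} X J 1)
  filtered : IsFiltered nabla (Set.Ici a) J

variable {L nabla delta : Λ → C} {i : ∀ a, L a ⟶ nabla a} {p : ∀ a, delta a ⟶ L a}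
  (hL : IsSimpleLabelling L) (hΛ : ∀ a : Λ, (Set.Iic a).Finite)

lemma IsCostandard.isPartialHull (hN : IsCostandard.{w} L nabla i) {a : Λ} {Ω : Set Λ}
    (hΩ : IsLowerSet Ω) (hfin : Ω.Finite) (ha : Maximal (· ∈ Ω) a) :
    IsPartialHull.{w} L nabla Ω Ω (i a) where
  mem := serreSub_mono L (hΩ.Iic_subset ha.prop) _ (hN.mem a)
  mono := hN.mono a
  essential := hN.essential a
  ext_one := hN.ext_one a Ω hΩ hfin ha
  filtered := .of_mem (Set.mem_Ici.2 le_rfl) (Iso.refl _)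

variable {Ω : Set Λ} {a b : Λ} {J : C} {j : L a ⟶ J}

include hL in
lemma IsPartialHull.iso_of_simple {Ω' : Set Λ} (hJ : IsPartialHull.{w} L nabla Ω Ω' j) {T : C}
    [Simple T] (t : T ⟶ J) (ht : t ≠ 0) : ∃ e : L a ≅ T, e.hom ≫ t = j := by
  have := hL.simple a
  have := hJ.mono
  have : Mono t := mono_of_nonzero_from_simple ht
  obtain ⟨u, hu⟩ := exists_factor_of_essential j hJ.essential t ht
  have hu0 : u ≠ 0 := fun h => id_nonzero (L a) (by
    rw [← cancel_mono j, ← hu, h, zero_comp, comp_zero, zero_comp])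
  have := isIso_of_hom_simple hu0
  exact ⟨asIso u, hu⟩

include hL hΛ in
/-- `Ext²` from `C_Ω` to a partial hull vanishes. -/
lemma IsPartialHull.ext_two (hN : IsCostandard.{w} L nabla i) (hD : IsStandard.{w} L delta p)
    (hm : ∀ a, HasMultiplicity (nabla a) (L a) 1)
    (hE : ∀ a b, Subsingleton (Ext.{w} (delta a) (nabla b) 2)) (hΩ : IsLowerSet Ω) {Ω' : Set Λ}
    (hJ : IsPartialHull.{w} L nabla Ω Ω' j) {X : C} (hX : serreSub L Ω X) :
    Subsingleton (Ext.{w} X J 2) := by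
  refine ext_subsingleton_of_serreSub_left (fun a _ => hL.simple a) (fun c hc => ?_) hX
  have := hD.epi c
  -- Ext²(L(c), J) sits between Ext¹(rad Δ(c), J) and Ext²(Δ(c), J), and both vanish.
  refine ext_subsingleton_left₃ (n := 1) (shortExact_of_epi (p c)) (hJ.ext_one _ ?_)
    (ext_subsingleton_of_isFiltered hJ.filtered fun d _ => hE c d)
  exact serreSub_mono L (fun d hd => hΩ (le_of_lt hd) hc) _ (hD.kernel_mem hL hN hm hΛ c)

variable (k : Type*) [Field k] [Linear k C] (hk : ∀ X Y : C, Module.Finite k (X ⟶ Y))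

include hL hΛ hk

omit hΛ in
-- A morphism vanishing on the kernel factors through L(b), but the socle of `J` is L(a). This bound
-- makes the enlargement procedure terminate.
lemma IsPartialHull.finrank_le (hD : IsStandard.{w} L delta p) {Ω' : Set Λ} (hab : a ≠ b)
    (hJ : IsPartialHull.{w} L nabla Ω Ω' j) :
    Module.finrank k (delta b ⟶ J) ≤ Module.finrank k (kernel (p b) ⟶ J) := by
  have := hD.epi b
  refine LinearMap.finrank_le_finrank_of_injective (f := Linear.leftComp k J (kernel.ι (p b))) ?_
  rw [← LinearMap.ker_eq_bot, LinearMap.ker_eq_bot']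
  intro g hg
  obtain ⟨t, rfl⟩ := desc_of_shortExact (shortExact_of_epi (p b)) g hg
  by_cases ht : t = 0
  · rw [ht, comp_zero]
  · have : Simple (ShortComplex.mk (kernel.ι (p b)) (p b) (kernel.condition _)).X₃ := hL.simple b
    obtain ⟨e, -⟩ := hJ.iso_of_simple hL t ht
    exact (hab (hL.injective a b ⟨e⟩)).elim

/-- If a partial hull is not injective, then it can be enlarged by a copy of `nabla b`. -/
lemma IsPartialHull.enlarge (hC : FiniteLength C) (hN : IsCostandard.{w} L nabla i)
    (hD : IsStandard.{w} L delta p) (hm : ∀ a, HasMultiplicity (nabla a) (L a) 1)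
    (hE : ∀ a b, Subsingleton (Ext.{w} (delta a) (nabla b) 2)) (hΩ : IsLowerSet Ω)
    (hΩ' : IsLowerSet (insert b Ω)) (hfin : Ω.Finite) (hb : b ∉ Ω) (hab : a ≤ b)
    (hJ : IsPartialHull.{w} L nabla Ω (insert b Ω) j) (h : ¬ Subsingleton (Ext.{w} (L b) J 1)) :
    ∃ (J' : C) (j' : L a ⟶ J'), IsPartialHull.{w} L nabla Ω (insert b Ω) j' ∧
      Module.finrank k (delta b ⟶ J) < Module.finrank k (delta b ⟶ J') ∧
      Module.finrank k (kernel (p b) ⟶ J') ≤ Module.finrank k (kernel (p b) ⟶ J) := by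
  obtain ⟨e, he⟩ : ∃ e : Ext.{w} (L b) J 1, e ≠ 0 := by
    by_contra! h'
    exact h (subsingleton_of_forall_eq 0 h')
  have hsub : Set.Iio b ⊆ Ω := fun c hc =>
    (hΩ' (le_of_lt hc) (Set.mem_insert b Ω)).resolve_left (ne_of_lt hc)
  have hmax : Maximal (· ∈ insert b Ω) b := by
    refine ⟨Set.mem_insert b Ω, fun c hc hbc => ?_⟩
    rcases hc with rfl | hc
    · exact le_rfl
    · exact (hb (hΩ hbc hc)).elim
  have hextN := hN.ext_one b _ hΩ' (hfin.insert b) hmax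
  have := hN.mono b
  have := hL.simple b
  have hSi := shortExact_of_mono (i b)
  have hQ := serreSub_quotient_of_hasMultiplicity hL hSi (Iso.refl _) (hN.mem b) (hm b)
  -- ∇(b)/L(b) lies in `C_Ω`, so the obstruction to extending the class `e` from L(b) to ∇(b)
  -- vanishes.
  have := hJ.ext_two hL hΛ hN hD hm hE hΩ (serreSub_mono L hsub _ hQ)
  obtain ⟨e', he'⟩ := Ext.contravariant_sequence_exact₁ hSi J e (add_comm 1 1)
    (Subsingleton.elim _ _)
  obtain ⟨J', f, g, w, hS, rfl⟩ := exists_extClass_eq e'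
  have := hS.mono_f
  have := hJ.mono
  -- A simple subobject of the kernel of `g'` either lies in `J` and is the socle L(a), which `g'`
  -- does not kill, or maps onto the socle L(b) of ∇(b) and splits the extension there, against `e ≠
  -- 0`.
  have hess : ∀ ⦃Z : C⦄ (g : J' ⟶ Z), (j ≫ f) ≫ g ≠ 0 → Mono g := by
    intro Z g' hg'
    by_contra hmono
    have hK : ¬ IsZero (kernel g') := fun hz =>
      hmono (Preadditive.mono_of_kernel_iso_zero (hz.isoZero))
    obtain ⟨T, hT, t, ht⟩ := hC.exists_simple_mono hK
    have ht0 : t ≫ kernel.ι g' ≠ 0 := fun h0 => id_nonzero T (by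
      rw [← cancel_mono (t ≫ kernel.ι g'), h0, comp_zero, comp_zero])
    by_cases hz : (t ≫ kernel.ι g') ≫ g = 0
    · obtain ⟨t', ht'⟩ := lift_of_shortExact hS _ hz
      dsimp at t' ht'
      obtain ⟨θ, hθ⟩ := hJ.iso_of_simple hL t' fun h0 => ht0 (by rw [← ht', h0, zero_comp])
      refine hg' ?_
      rw [← hθ, Category.assoc θ.hom, ht', Category.assoc, Category.assoc, kernel.condition,
        comp_zero, comp_zero]
    · obtain ⟨θ, hθ⟩ := hN.exists_iso_of_simple hL _ hz
      refine he ?_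
      rw [← he']
      exact mk₀_comp_extClass_eq_zero_of_lift hS (i b) (θ.hom ≫ t ≫ kernel.ι g')
        (by rw [← hθ]; simp)
  refine ⟨J', j ≫ f, ⟨?_, mono_comp _ _, hess, ?_, ?_⟩, ?_, ?_⟩
  · exact (serreSub L _).prop_X₂_of_shortExact hS hJ.mem
      (serreSub_mono L (hΩ'.Iic_subset (Set.mem_insert b Ω)) _ (hN.mem b))
  · exact fun X hX => ext_subsingleton_right₂ hS (hJ.ext_one X hX)
      (hextN X (serreSub_mono L (Set.subset_insert b Ω) _ hX))
  · exact .cons hS hJ.filtered (Set.mem_Ici.2 hab) (Iso.refl _)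
  -- The composite Δ(b) → L(b) → ∇(b) lifts to `J'` because Ext¹(Δ(b), J) = 0; being nonzero, it
  -- shows that the lift does not come from `J`.
  · let φ := Linear.rightComp k (delta b) f
    have hφ : Function.Injective φ := fun x y hxy => (cancel_mono f).1 hxy
    rw [← LinearMap.finrank_range_of_inj hφ]
    refine Submodule.finrank_lt fun htop => ?_
    have : Subsingleton (Ext.{w} (delta b) J 1) := ext_subsingleton_of_isFiltered hJ.filtered
      fun d _ => ext_one_standard_costandard hΛ hN hD b d
    obtain ⟨y, hy⟩ := exists_hom_lift hS this (p b ≫ i b)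
    obtain ⟨x, rfl⟩ : y ∈ LinearMap.range φ := by rw [htop]; trivial
    have h0 : p b ≫ i b = 0 := by
      rw [← hy]
      exact (Category.assoc x f g).trans (by rw [w, comp_zero])
    have := hD.epi b
    exact hN.i_ne_zero hL b (by rw [← cancel_epi (p b), h0, comp_zero])
  -- rad Δ(b) lies in `C_{< b}` and has no nonzero map to ∇(b), so its maps to `J'` land in `J`.
  · have : Function.Surjective (Linear.rightComp k (kernel (p b)) f) := by
      intro y
      obtain ⟨x, hx⟩ := lift_of_shortExact hS y (hN.hom_eq_zero hL (by simp)
        (hD.kernel_mem hL hN hm hΛ b) (y ≫ g))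
      exact ⟨x, hx⟩
    exact LinearMap.finrank_le_finrank_of_surjective this

/-- The inductive step in the construction of injective hulls in `C_Ω`. -/
lemma IsPartialHull.complete (hC : FiniteLength C) (hN : IsCostandard.{w} L nabla i)
    (hD : IsStandard.{w} L delta p) (hm : ∀ a, HasMultiplicity (nabla a) (L a) 1)
    (hE : ∀ a b, Subsingleton (Ext.{w} (delta a) (nabla b) 2)) (hΩ : IsLowerSet Ω)
    (hΩ' : IsLowerSet (insert b Ω)) (hfin : Ω.Finite) (hb : b ∉ Ω) (hab : a < b) (n : ℕ) :
    ∀ (J : C) (j : L a ⟶ J), IsPartialHull.{w} L nabla Ω (insert b Ω) j →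
      Module.finrank k (kernel (p b) ⟶ J) - Module.finrank k (delta b ⟶ J) = n →
      ∃ (J' : C) (j' : L a ⟶ J'), IsPartialHull.{w} L nabla (insert b Ω) (insert b Ω) j' := by
  induction n using Nat.strong_induction_on with
  | _ n ih =>
    intro J j hJ hn
    by_cases h : Subsingleton (Ext.{w} (L b) J 1)
    · refine ⟨J, j, { hJ with ext_one := fun X hX => ?_ }⟩
      refine ext_subsingleton_of_serreSub_left (fun a _ => hL.simple a) (fun c hc => ?_) hX
      rcases hc with rfl | hc
      · exact h
      · exact hJ.ext_one _ (serreSub_mem L hc)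
    · obtain ⟨J', j', hJ', h₁, h₂⟩ := hJ.enlarge hL hΛ k hk hC hN hD hm hE hΩ hΩ' hfin hb hab.le h
      -- Ensures that the truncated difference of dimensions really drops.
      have h₃ := hJ'.finrank_le hL k hk hD hab.ne
      exact ih _ (by omega) J' j' hJ' rfl

/-- Each `L a` has a hull in `C_Ω` which is filtered by the `nabla b` with `b ≥ a`. -/
theorem exists_isPartialHull (hC : FiniteLength C) (hN : IsCostandard.{w} L nabla i)
    (hD : IsStandard.{w} L delta p) (hm : ∀ a, HasMultiplicity (nabla a) (L a) 1)
    (hE : ∀ a b, Subsingleton (Ext.{w} (delta a) (nabla b) 2)) (hΩ : IsLowerSet Ω)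
    (hfin : Ω.Finite) (ha : a ∈ Ω) :
    ∃ (J : C) (j : L a ⟶ J), IsPartialHull.{w} L nabla Ω Ω j := by
  induction hn : Ω.ncard using Nat.strong_induction_on generalizing Ω with
  | _ n ih =>
    by_cases hmax : Maximal (· ∈ Ω) a
    · exact ⟨_, _, hN.isPartialHull hΩ hfin hmax⟩
    · obtain ⟨b, hab, hb⟩ := hfin.exists_le_maximal ha
      have hab' : a < b := lt_of_le_of_ne hab (by rintro rfl; exact hmax hb)
      have hlow : IsLowerSet (Ω \ {b}) := by
        rintro x y hyx ⟨hx, hxb⟩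
        refine ⟨hΩ hyx hx, ?_⟩
        rintro rfl
        exact hxb (le_antisymm (hb.2 hx hyx) hyx)
      have hins : insert b (Ω \ {b}) = Ω := Set.insert_sdiff_self_of_mem hb.prop
      have hcard : (Ω \ {b}).ncard < n := by
        rw [← hn]; exact Set.ncard_sdiff_singleton_lt_of_mem hb.prop hfin
      obtain ⟨J, j, hJ⟩ := ih _ hcard hlow hfin.sdiff ⟨ha, hab'.ne⟩ rfl
      have hJ' : IsPartialHull.{w} L nabla (Ω \ {b}) (insert b (Ω \ {b})) j :=
        { hJ with mem := serreSub_mono L (Set.subset_insert _ _) _ hJ.mem }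
      have := hJ'.complete hL hΛ k hk hC hN hD hm hE hlow (by rwa [hins]) hfin.sdiff
        (by simp) hab' _ J j rfl
      rwa [hins] at this

end Hulls

/-! ### Projective covers in finite categories -/

section ProjectiveCovers

variable {A : Type*} [Category* A] [Abelian A]

/-- `Y` is cogenerated by `G`: the morphisms from `Y` to `G` are jointly monic. -/
def IsCogeneratedBy (G Y : A) : Prop :=
  ∀ ⦃N : A⦄ (f : N ⟶ Y), (∀ g : Y ⟶ G, f ≫ g = 0) → f = 0

lemma IsCogeneratedBy.of_mono {G Y Y' : A} (h : IsCogeneratedBy G Y) (m : Y' ⟶ Y) [Mono m] :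
    IsCogeneratedBy G Y' := fun N f hf => by
  rw [← cancel_mono m, zero_comp]
  exact h _ fun g => by rw [Category.assoc]; exact hf _

/-- Since the subcategory contains `G`, every object of a finite category with generator `G` is a
quotient of an object cogenerated by `G`. -/
lemma isTopologising_isCogeneratedBy (G : A) :
    IsTopologising (fun X : A => ∃ (Y : A) (p : Y ⟶ X), IsCogeneratedBy G Y ∧ Epi p) where
  containsZero := ⟨⟨_, isZero_zero A, _, 𝟙 _, fun _ _ _ => (isZero_zero A).eq_of_tgt _ _,
    inferInstance⟩⟩
  biprod := by
    rintro X X' ⟨Y, p, hY, hp⟩ ⟨Y', p', hY', hp'⟩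
    refine ⟨Y ⊞ Y', biprod.map p p', fun N f hf => ?_, inferInstance⟩
    apply biprod.hom_ext
    · rw [zero_comp]
      exact hY _ fun g => by rw [Category.assoc]; exact hf _
    · rw [zero_comp]
      exact hY' _ fun g => by rw [Category.assoc]; exact hf _
  closedUnderSubobjects := ⟨by
    rintro X X' m hm ⟨Y, p, hY, hp⟩
    exact ⟨pullback m p, pullback.fst m p, hY.of_mono (pullback.snd m p), inferInstance⟩⟩
  closedUnderQuotients := ⟨by
    rintro X X' q hq ⟨Y, p, hY, hp⟩
    exact ⟨Y, p ≫ q, hY, epi_comp _ _⟩⟩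

/-- Each epimorphism from an artinian object restricts to a superfluous epimorphism on some
subobject. -/
lemma exists_superfluous_restriction {E X : A} [IsArtinianObject E] (f : E ⟶ X) [Epi f] :
    ∃ (M : A) (m : M ⟶ E), Mono m ∧ Epi (m ≫ f) ∧
      ∀ ⦃Z : A⦄ (g : Z ⟶ M), Epi (g ≫ m ≫ f) → Epi g := by
  -- A minimal subobject that still surjects onto `X` has the required property.
  let s : Set (Subobject E) := {M | Epi (M.arrow ≫ f)}
  have hs : s.Nonempty := ⟨⊤, by
    change Epi ((⊤ : Subobject E).arrow ≫ f)
    exact epi_comp _ _⟩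
  obtain ⟨M, hM, hmin⟩ := WellFounded.has_min (wellFounded_lt (α := Subobject E)) s hs
  refine ⟨M, M.arrow, inferInstance, hM, fun Z g hg => ?_⟩
  let N : Subobject E := Subobject.mk (Abelian.image.ι g ≫ M.arrow)
  have hle : N ≤ M := Subobject.mk_le_of_comm (Abelian.image.ι g) rfl
  have hN : N ∈ s := by
    change Epi (N.arrow ≫ f)
    have : Epi ((Abelian.factorThruImage g ≫
        (Subobject.underlyingIso (Abelian.image.ι g ≫ M.arrow)).inv) ≫ N.arrow ≫ f) := by
      convert hg using 1
      simp [N]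
    exact epi_of_epi (Abelian.factorThruImage g ≫
        (Subobject.underlyingIso (Abelian.image.ι g ≫ M.arrow)).inv) _
  have hNM : M ≤ N := by
    by_contra h
    exact hmin N hN (lt_of_le_not_ge hle h)
  obtain ⟨u, hu⟩ : ∃ u : (M : A) ⟶ Abelian.image g, u ≫ Abelian.image.ι g ≫ M.arrow = M.arrow :=
    (Subobject.mk_factors_iff _ _).1 (Subobject.factors_of_le _ hNM
      (Subobject.factors_self M))
  have hu' : u ≫ Abelian.image.ι g = 𝟙 _ := by
    rw [← cancel_mono M.arrow, Category.assoc, hu, Category.id_comp]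
  have : Epi (Abelian.image.ι g) := (SplitEpi.mk u hu').epi
  rw [← Abelian.image.fac g]
  exact epi_comp _ _

variable (k : Type*) [Field k] [Linear k A]

/-- The dimension of the space of morphisms to a fixed object from an object with simple top `S`
is bounded. -/
lemma exists_finrank_bound (hA : FiniteLength A) (hk : ∀ X Y : A, Module.Finite k (X ⟶ Y)) {S : A}
    [Simple S] (Y : A) : ∃ m : ℕ, ∀ (Q : A) (q : Q ⟶ S), q ≠ 0 →
      (∀ ⦃Z : A⦄ (g : Z ⟶ Q), g ≫ q ≠ 0 → Epi g) → Module.finrank k (Q ⟶ Y) ≤ m := by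
  refine hA.induction (fun Y => ∃ m : ℕ, ∀ (Q : A) (q : Q ⟶ S), q ≠ 0 →
      (∀ ⦃Z : A⦄ (g : Z ⟶ Q), g ≫ q ≠ 0 → Epi g) → Module.finrank k (Q ⟶ Y) ≤ m) ?_ ?_ ?_ Y
  · intro Y hY
    refine ⟨0, fun Q q _ _ => ?_⟩
    have : Subsingleton (Q ⟶ Y) := ⟨fun f g => hY.eq_of_tgt f g⟩
    rw [Module.finrank_zero_of_subsingleton]
  · intro T hT
    refine ⟨Module.finrank k (S ⟶ T), fun Q q hq0 hq => ?_⟩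
    have := hk Q T
    have := hk S T
    have : Epi q := epi_of_nonzero_to_simple hq0
    refine LinearMap.finrank_le_finrank_of_surjective (f := Linear.leftComp k T q) fun f => ?_
    refine desc_of_shortExact (shortExact_of_epi q) f ?_
    dsimp
    by_cases hf : f = 0
    · rw [hf, comp_zero]
    have : Epi f := epi_of_nonzero_to_simple hf
    obtain ⟨u, hu⟩ := exists_factor_of_superfluous q hq f hf
    have : IsIso u := isIso_of_hom_simple fun h => hq0 (by rw [← hu, h, comp_zero])
    rw [← cancel_mono u, Category.assoc, hu, kernel.condition, zero_comp]
  · rintro R hR ⟨m₁, h₁⟩ ⟨m₃, h₃⟩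
    refine ⟨m₃ + m₁, fun Q q hq0 hq => ?_⟩
    have := hk Q R.X₂
    let φ := Linear.rightComp k Q R.g
    let ψ := Linear.rightComp k Q R.f
    have hle : LinearMap.ker φ ≤ LinearMap.range ψ := fun x hx =>
      lift_of_shortExact hR x hx
    have := hk Q R.X₁
    have := hk Q R.X₃
    rw [← LinearMap.finrank_range_add_finrank_ker φ]
    exact add_le_add ((Submodule.finrank_le _).trans (h₃ Q q hq0 hq))
      ((Submodule.finrank_mono hle).trans ((LinearMap.finrank_range_le ψ).trans (h₁ Q q hq0 hq)))

/-- In a finite category, each simple object has a projective cover. -/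
theorem IsFiniteCategory.exists_isProjectiveCover (h : IsFiniteCategory k A) (S : A) [Simple S] :
    ∃ (P : A) (p : P ⟶ S), IsProjectiveCover p := by
  have hA : FiniteLength A := ⟨h.noetherian, h.artinian⟩
  obtain ⟨G, hG⟩ := h.exists_generator
  have hcog : ∀ X : A, ∃ (Y : A) (p : Y ⟶ X), IsCogeneratedBy G Y ∧ Epi p :=
    hG _ (isTopologising_isCogeneratedBy G) ⟨G, 𝟙 G, fun N f hf => by
      rw [← hf (𝟙 G), Category.comp_id], inferInstance⟩
  -- Objects with simple top `S` that are cogenerated by `G`; the cover is one with dim Hom(Q, G)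
  -- maximal.
  let IsLocal (Q : A) (q : Q ⟶ S) : Prop :=
    IsCogeneratedBy G Q ∧ q ≠ 0 ∧ ∀ ⦃Z : A⦄ (g : Z ⟶ Q), g ≫ q ≠ 0 → Epi g
  -- local objects can be found above any epimorphism to a local object
  have hloc : ∀ (X : A) (x : X ⟶ S), x ≠ 0 → (∀ ⦃Z : A⦄ (g : Z ⟶ X), g ≫ x ≠ 0 → Epi g) →
      ∀ (E : A) (e : E ⟶ X), Epi e → ∃ (Q : A) (m : Q ⟶ E), Epi (m ≫ e) ∧
        IsLocal Q (m ≫ e ≫ x) := by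
    intro X x hx0 hx E e he
    obtain ⟨Y, y, hY, hy⟩ := hcog E
    have := hA.artinian Y
    have := epi_comp y e
    obtain ⟨Q, m, hm, hme, hsup⟩ := exists_superfluous_restriction (y ≫ e)
    refine ⟨Q, m ≫ y, by simpa using hme, hY.of_mono m, fun h0 => hx0 ?_, fun Z g hg =>
      hsup g (hx _ ?_)⟩
    · rw [← cancel_epi (m ≫ y ≫ e), comp_zero, ← h0]
      simp
    · simpa using hg
  obtain ⟨Q₀, m₀, -, h₀⟩ := hloc S (𝟙 S) (id_nonzero S) (fun Z g hg => by
    rw [Category.comp_id] at hg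
    exact epi_of_nonzero_to_simple hg) S (𝟙 S) inferInstance
  obtain ⟨m, hm⟩ := exists_finrank_bound k hA h.finite_hom (S := S) G
  let s : Set ℕ := {n | ∃ (Q : A) (q : Q ⟶ S), IsLocal Q q ∧ Module.finrank k (Q ⟶ G) = n}
  have hbdd : BddAbove s := ⟨m, by
    rintro _ ⟨Q, q, ⟨-, hq0, hq⟩, rfl⟩
    exact hm Q q hq0 hq⟩
  obtain ⟨P, p, ⟨hP, hp0, hp⟩, hmax⟩ := Nat.sSup_mem (s := s) ⟨_, Q₀, _, h₀, rfl⟩ hbdd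
  refine ⟨P, p, epi_of_nonzero_to_simple hp0, ⟨fun {E X} f e he => ?_⟩, fun Z g hg => hp g ?_⟩
  -- A local `Q` over the pullback surjects onto `P`. By maximality Hom(P, G) → Hom(Q, G) is
  -- bijective, and as `G` cogenerates `Q`, the kernel of `Q → P` is zero. The inverse of this
  -- isomorphism yields the lift.
  · obtain ⟨Q, m, hme, hQ⟩ := hloc P p hp0 hp (pullback f e) (pullback.fst f e) inferInstance
    have := h.finite_hom P G
    have := h.finite_hom Q G
    let φ := Linear.leftComp k G (m ≫ pullback.fst f e)
    have hφ : Function.Injective φ := fun x y hxy =>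
      (cancel_epi (m ≫ pullback.fst f e)).1 hxy
    have hle : Module.finrank k (Q ⟶ G) ≤ Module.finrank k (P ⟶ G) := by
      rw [hmax]
      exact le_csSup hbdd ⟨Q, _, hQ, rfl⟩
    have hsurj : Function.Surjective φ := (LinearMap.injective_iff_surjective_of_finrank_eq_finrank
      (le_antisymm (LinearMap.finrank_le_finrank_of_injective hφ) hle)).1 hφ
    have hker : kernel.ι (m ≫ pullback.fst f e) = 0 := hQ.1 _ fun g => by
      obtain ⟨g', rfl⟩ := hsurj g
      change kernel.ι (m ≫ pullback.fst f e) ≫ (m ≫ pullback.fst f e) ≫ g' = 0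
      rw [← Category.assoc, kernel.condition, zero_comp]
    have : Mono (m ≫ pullback.fst f e) := Preadditive.mono_of_kernel_zero hker
    have : IsIso (m ≫ pullback.fst f e) := isIso_of_mono_of_epi _
    refine ⟨inv (m ≫ pullback.fst f e) ≫ m ≫ pullback.snd f e, ?_⟩
    rw [Category.assoc, Category.assoc, ← pullback.condition, ← Category.assoc m,
      IsIso.inv_hom_id_assoc]
  · rintro h0
    rw [h0] at hg
    exact id_nonzero S (by rw [← cancel_epi (0 : Z ⟶ S), zero_comp, zero_comp])

end ProjectiveCovers

/-! ### Finiteness of truncations -/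

section FiniteTrunc

open Abelian ZeroObject

variable {C : Type u} [Category.{v} C] [Abelian C] {Λ : Type*} {L : Λ → C} {Ω : Set Λ}

lemma trunc_lt_of_lt {X : Trunc L Ω} {M N : Subobject X} (h : M < N) :
    haveI := trunc_mono_hom M.arrow
    haveI := trunc_mono_hom N.arrow
    Subobject.mk M.arrow.hom < Subobject.mk N.arrow.hom := by
  have := trunc_mono_hom M.arrow
  have := trunc_mono_hom N.arrow
  refine lt_of_le_not_ge (Subobject.mk_le_mk_of_comm (Subobject.ofLE M N h.le).hom
    (congrArg (·.hom) (Subobject.ofLE_arrow h.le))) fun hle => h.not_ge ?_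
  obtain ⟨u, hu⟩ : ∃ u, u ≫ M.arrow.hom = N.arrow.hom :=
    ⟨Subobject.ofMkLEMk _ _ hle, Subobject.ofMkLEMk_comp hle⟩
  exact Subobject.le_of_comm (ObjectProperty.homMk u) (by ext; exact hu)

lemma trunc_finiteLength (hC : FiniteLength C) : FiniteLength (Trunc L Ω) where
  noetherian X := by
    rw [isNoetherianObject_iff_not_strictMono]
    intro f hf
    have := hC.noetherian X.obj
    have := fun n => trunc_mono_hom (f n).arrow
    exact not_strictMono_of_isNoetherianObject (fun n => Subobject.mk (f n).arrow.hom)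
      fun m n h => trunc_lt_of_lt (hf h)
  artinian X := by
    rw [isArtinianObject_iff_not_strictAnti]
    intro f hf
    have := hC.artinian X.obj
    have := fun n => trunc_mono_hom (f n).arrow
    exact not_strictAnti_of_isArtinianObject (fun n => Subobject.mk (f n).arrow.hom)
      fun m n h => trunc_lt_of_lt (hf h)

lemma trunc_finite_hom (k : Type*) [Field k] [Linear k C]
    (hk : ∀ X Y : C, Module.Finite k (X ⟶ Y)) (X Y : Trunc L Ω) : Module.Finite k (X ⟶ Y) := by
  have := hk X.obj Y.obj
  exact Module.Finite.of_injective ((serreSub L Ω).ι.mapLinearMap k (X := X) (Y := Y))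
    (serreSub L Ω).ι.map_injective

/-- `C_Ω` is finite if each simple object of it embeds into an injective object of `C_Ω`. -/
theorem isFiniteCategory_trunc (k : Type*) [Field k] [Linear k C] (hC : IsFiniteLengthCategory k C)
    (hL : IsSimpleLabelling L) (hΩ : Ω.Finite)
    (h : ∀ a ∈ Ω, ∃ (N : Trunc L Ω) (f : L a ⟶ N.obj), Injective N ∧ Mono f) :
    IsFiniteCategory k (Trunc L Ω) := by
  have hC' : FiniteLength C := ⟨hC.noetherian, hC.artinian⟩
  refine ⟨⟨(trunc_finiteLength hC').noetherian, (trunc_finiteLength hC').artinian,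
    trunc_finite_hom k hC.finite_hom⟩, ?_⟩
  let := HasExt.standard C
  have key : ∀ F : Set Λ, F.Finite → F ⊆ Ω → ∃ G : Trunc L Ω, Injective G ∧
      ∀ a ∈ F, ∃ f : L a ⟶ G.obj, Mono f := by
    intro F hF
    induction F, hF using Set.Finite.induction_on with
    | empty => exact fun _ => ⟨0, inferInstance, by simp⟩
    | @insert a F _ _ ih =>
      intro hsub
      obtain ⟨G, hG, hGF⟩ := ih ((Set.subset_insert a F).trans hsub)
      obtain ⟨N, f, hN, hf⟩ := h a (hsub (Set.mem_insert a F))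
      refine ⟨N ⊞ G, inferInstance, fun b hb => ?_⟩
      rcases hb with rfl | hb
      · have := trunc_mono_hom (biprod.inl : N ⟶ N ⊞ G)
        exact ⟨f ≫ (biprod.inl : N ⟶ N ⊞ G).hom, mono_comp _ _⟩
      · obtain ⟨f', hf'⟩ := hGF b hb
        have := trunc_mono_hom (biprod.inr : G ⟶ N ⊞ G)
        exact ⟨f' ≫ (biprod.inr : G ⟶ N ⊞ G).hom, mono_comp _ _⟩
  obtain ⟨G, hG, hGΩ⟩ := key Ω hΩ le_rfl
  refine ⟨G, fun P hP hPG X => ?_⟩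
  -- A horseshoe argument embeds each object in an injective object of `P`, starting from `G`, which
  -- contains all simple objects of `C_Ω`.
  suffices H : ∃ (N : Trunc L Ω) (f : X.obj ⟶ N.obj), Injective N ∧ P N ∧ Mono f by
    obtain ⟨N, f, -, hN, hf⟩ := H
    have := hP.closedUnderSubobjects
    have : Mono (ObjectProperty.homMk f : X ⟶ N) := trunc_mono_of_hom _ hf
    exact P.prop_of_mono (ObjectProperty.homMk f : X ⟶ N) hN
  refine serreSub_induction (fun a _ => hL.simple a) X.property
    (fun X => ∃ (N : Trunc L Ω) (f : X ⟶ N.obj), Injective N ∧ P N ∧ Mono f) ?_ ?_ ?_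
  · exact fun X hX => ⟨G, 0, hG, hPG, ⟨fun _ _ _ => hX.eq_of_tgt _ _⟩⟩
  · intro a ha
    obtain ⟨f, hf⟩ := hGΩ a ha
    exact ⟨G, f, hG, hPG, hf⟩
  · rintro S hS h₁ h₃ ⟨N₁, f₁, hN₁, hP₁, hf₁⟩ ⟨N₃, f₃, hN₃, hP₃, hf₃⟩
    obtain ⟨u, hu⟩ := exists_hom_extension hS ((trunc_injective_iff N₁).1 hN₁ _ h₃) f₁
    let X₂ : Trunc L Ω := ⟨S.X₂, (serreSub L Ω).prop_X₂_of_shortExact hS h₁ h₃⟩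
    let m : X₂ ⟶ N₁ ⊞ N₃ := biprod.lift (ObjectProperty.homMk u) (ObjectProperty.homMk (S.g ≫ f₃))
    refine ⟨N₁ ⊞ N₃, m.hom, inferInstance, hP.biprod _ _ hP₁ hP₃, ?_⟩
    refine Preadditive.mono_of_cancel_zero _ fun {Z} z hz => ?_
    have hz₁ : z ≫ u = 0 := by
      have h : m ≫ (biprod.fst : N₁ ⊞ N₃ ⟶ N₁) = ObjectProperty.homMk u := biprod.lift_fst _ _
      have : m.hom ≫ (biprod.fst : N₁ ⊞ N₃ ⟶ N₁).hom = u :=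
        congrArg (fun f : X₂ ⟶ N₁ => f.hom) h
      rw [← this, ← Category.assoc, hz, zero_comp]
    have hz₃ : z ≫ S.g = 0 := by
      have h : m ≫ (biprod.snd : N₁ ⊞ N₃ ⟶ N₃) = ObjectProperty.homMk (S.g ≫ f₃) :=
        biprod.lift_snd _ _
      have : m.hom ≫ (biprod.snd : N₁ ⊞ N₃ ⟶ N₃).hom = S.g ≫ f₃ :=
        congrArg (fun f : X₂ ⟶ N₃ => f.hom) h
      rw [← cancel_mono f₃, Category.assoc, ← this, ← Category.assoc, hz, zero_comp, zero_comp]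
    obtain ⟨z', rfl⟩ := lift_of_shortExact hS z hz₃
    rw [Category.assoc, hu] at hz₁
    rw [(cancel_mono f₁).1 (hz₁.trans zero_comp.symm), zero_comp]

end FiniteTrunc

/-! ### Injective hulls of simple objects in the ind-completion -/

section InjectiveHulls

variable {C : Type u} [Category.{v} C] [Abelian C] {D : Type*} [Category* D] [Abelian D]
  {T : C ⥤ D} (hT : IsCompactEmbedding T)

include hT

lemma IsCompactEmbedding.additive : T.Additive := by
  have := hT.preservesFiniteLimits
  exact T.additive_of_preserves_binary_products

lemma IsCompactEmbedding.mono_of_forall {Y Z : D} (g : Y ⟶ Z)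
    (h : ∀ (X : C) (u : T.obj X ⟶ Y), u ≫ g = 0 → u = 0) : Mono g := by
  refine Preadditive.mono_of_cancel_zero _ fun {W} z hz => ?_
  exact hT.separating z fun X u => h X _ (by rw [Category.assoc, hz, comp_zero])

lemma IsCompactEmbedding.mono_map {X Y : C} (f : X ⟶ Y) [Mono f] : Mono (T.map f) := by
  have := hT.preservesFiniteLimits
  infer_instance

lemma IsCompactEmbedding.epi_map {X Y : C} (f : X ⟶ Y) [Epi f] : Epi (T.map f) := by
  have := hT.preservesFiniteColimits
  infer_instance

/-- The kernel is tested on objects of `C`, whose nonzero morphisms to the simple object are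
epimorphisms. -/
lemma IsCompactEmbedding.mono_of_ne_zero {X : C} [Simple X] {Z : D} (f : T.obj X ⟶ Z)
    (hf : f ≠ 0) : Mono f := by
  have := hT.full
  have := hT.faithful
  refine hT.mono_of_forall f fun W u hu => ?_
  obtain ⟨u, rfl⟩ := T.map_surjective u
  have := hT.additive
  by_contra h0
  have : u ≠ 0 := fun h => h0 (by rw [h, T.map_zero])
  have : Epi u := epi_of_nonzero_to_simple this
  have := hT.epi_map u
  exact hf (by rw [← cancel_epi (T.map u), hu, comp_zero])

omit hT in
/-- A factorization of a morphism through a subobject `M` such that `E ⟶ E/M` is essential on `S`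
for a maximal subobject `M` not containing `S`. -/
lemma essential_cokernel_of_maximal {S E : D} (s : S ⟶ E) {M : Subobject E}
    (hM : Maximal (· ∈ {M : Subobject E | ¬ M.Factors s}) M) ⦃Z : D⦄
    (g : cokernel M.arrow ⟶ Z) (hg : (s ≫ cokernel.π M.arrow) ≫ g ≠ 0) : Mono g := by
  have hle : M ≤ kernelSubobject (cokernel.π M.arrow ≫ g) := by
    refine le_kernelSubobject _ _ ?_
    rw [← Category.assoc, cokernel.condition, zero_comp]
  have hN : ¬ (kernelSubobject (cokernel.π M.arrow ≫ g)).Factors s := fun h => hg (by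
    rw [Category.assoc, ← Subobject.factorThru_arrow _ _ h, Category.assoc,
      kernelSubobject_arrow_comp, comp_zero])
  have hge := hM.2 hN hle
  refine Preadditive.mono_of_cancel_zero _ fun {W} z hz => ?_
  obtain ⟨W', p, hp, y, hy⟩ := surjective_up_to_refinements_of_epi (cokernel.π M.arrow) z
  have h1 : y ≫ cokernel.π M.arrow ≫ g = 0 := by
    rw [← Category.assoc, ← hy, Category.assoc, hz, comp_zero]
  have h2 : M.Factors y :=
    Subobject.factors_of_le _ hge ((kernelSubobject_factors_iff _ _).2 h1)
  rw [← cancel_epi p, hy, ← Subobject.factorThru_arrow _ _ h2, Category.assoc, cokernel.condition,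
    comp_zero, comp_zero]

/-- Simple objects have maximal essential extensions inside each given extension. -/
lemma IsCompactEmbedding.exists_maximal_essential {X : C} [Simple X] {E : D} (s : T.obj X ⟶ E)
    [Mono s] : ∃ K : Subobject E, Maximal (· ∈ {K : Subobject E |
      ∃ t : T.obj X ⟶ K, t ≫ K.arrow = s ∧ ∀ ⦃Z : D⦄ (g : (K : D) ⟶ Z), t ≫ g ≠ 0 → Mono g}) K := by
  have base : Subobject.mk s ∈ {K : Subobject E |
      ∃ t : T.obj X ⟶ K, t ≫ K.arrow = s ∧ ∀ ⦃Z : D⦄ (g : (K : D) ⟶ Z), t ≫ g ≠ 0 → Mono g} := by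
    refine ⟨(Subobject.underlyingIso s).inv, Subobject.underlyingIso_arrow s, fun Z g hg => ?_⟩
    have := hT.mono_of_ne_zero _ hg
    have h : g = (Subobject.underlyingIso s).hom ≫ (Subobject.underlyingIso s).inv ≫ g := by simp
    rw [h]
    exact mono_comp _ _
  suffices H : _ by
    obtain ⟨K, -, hK⟩ := zorn_le_nonempty₀ _ H _ base
    exact ⟨K, hK⟩
  · intro c hc hchain y hy
    obtain ⟨U, hU⟩ := hT.exists_isLUB c
    refine ⟨U, ?_, fun z hz => hU.1 hz⟩
    obtain ⟨t, ht, -⟩ := hc hy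
    have hle := hU.1 hy
    refine ⟨t ≫ Subobject.ofLE y U hle, by rw [Category.assoc, Subobject.ofLE_arrow, ht],
      fun Z g hg => hT.mono_of_forall g fun W u hu => ?_⟩
    -- By compactness a test morphism into the union of the chain lands in a member, where
    -- essentiality is known.
    obtain ⟨K, hKc, hK⟩ := hT.factors c ⟨y, hy⟩ hchain.directedOn U hU W (u ≫ U.arrow)
      (Subobject.factors_comp_arrow u)
    obtain ⟨t', ht', hess⟩ := hc hKc
    have hKU := hU.1 hKc
    have h1 : t' ≫ Subobject.ofLE K U hKU = t ≫ Subobject.ofLE y U hle := by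
      rw [← cancel_mono U.arrow, Category.assoc, Category.assoc, Subobject.ofLE_arrow,
        Subobject.ofLE_arrow, ht, ht']
    have : Mono (Subobject.ofLE K U hKU ≫ g) := hess _ (by rwa [← Category.assoc, h1])
    have h2 : u = K.factorThru _ hK ≫ Subobject.ofLE K U hKU := by
      rw [← cancel_mono U.arrow, Category.assoc, Subobject.ofLE_arrow, Subobject.factorThru_arrow]
    have h3 : K.factorThru _ hK = 0 := by
      rw [← cancel_mono (Subobject.ofLE K U hKU ≫ g), zero_comp, ← Category.assoc, ← h2, hu]
    rw [h2, h3, zero_comp]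

/-- Zorn's lemma: by compactness, `s` factors through the union of a chain only if it factors
through a member. -/
lemma IsCompactEmbedding.exists_maximal_not_factors {X : C} {E : D} (s : T.obj X ⟶ E)
    (hs : s ≠ 0) : ∃ M : Subobject E, Maximal (· ∈ {M : Subobject E | ¬ M.Factors s}) M := by
  have base : (⊥ : Subobject E) ∈ {M : Subobject E | ¬ M.Factors s} := fun h =>
    hs ((Subobject.bot_factors_iff_zero _).1 h)
  suffices H : _ by
    obtain ⟨M, -, hM⟩ := zorn_le_nonempty₀ _ H _ base
    exact ⟨M, hM⟩
  · intro c hc hchain y hy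
    obtain ⟨U, hU⟩ := hT.exists_isLUB c
    refine ⟨U, fun h => ?_, fun z hz => hU.1 hz⟩
    obtain ⟨K, hK, hKs⟩ := hT.factors c ⟨y, hy⟩ hchain.directedOn U hU X s h
    exact hc hK hKs

/-- Simple objects have injective hulls in the ind-completion. -/
theorem IsCompactEmbedding.exists_isInjectiveHull (X : C) [Simple X] :
    ∃ (I : D) (ι : T.obj X ⟶ I), IsInjectiveHull ι := by
  have := hT.enoughInjectives
  have := hT.faithful
  have := hT.additive
  let E := Injective.under (T.obj X)
  let s : T.obj X ⟶ E := Injective.ι (T.obj X)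
  have hX : 𝟙 (T.obj X) ≠ 0 := fun h => id_nonzero X (T.map_injective (by simpa using h))
  have hs : s ≠ 0 := fun h => hX (by rw [← cancel_mono s, h, comp_zero, comp_zero])
  -- `E/M` is an essential extension containing `K`, and it embeds back into the injective `E` over
  -- `K`. Maximality of `K` forces the image to be `K`, so `K` is a retract of `E`.
  obtain ⟨K, hK⟩ := hT.exists_maximal_essential s
  obtain ⟨M, hM⟩ := hT.exists_maximal_not_factors s hs
  have hMess := essential_cokernel_of_maximal s hM
  obtain ⟨t, ht, hKess⟩ := hK.prop
  have hsπ : s ≫ cokernel.π M.arrow ≠ 0 := fun h => by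
    obtain ⟨y, hy⟩ := lift_of_shortExact (shortExact_of_mono M.arrow) s h
    exact hM.prop ((Subobject.factors_iff _ _).2 ⟨y, hy⟩)
  have : Mono (K.arrow ≫ cokernel.π M.arrow) := hKess _ (by rwa [← Category.assoc, ht])
  let φ : cokernel M.arrow ⟶ E := Injective.factorThru K.arrow (K.arrow ≫ cokernel.π M.arrow)
  have hφ : (K.arrow ≫ cokernel.π M.arrow) ≫ φ = K.arrow := Injective.comp_factorThru _ _
  have hφs : (s ≫ cokernel.π M.arrow) ≫ φ = s := by
    rw [← ht, Category.assoc, Category.assoc, ← Category.assoc K.arrow, hφ]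
  have : Mono φ := hMess φ (by rwa [hφs])
  have hle : K ≤ Subobject.mk φ := Subobject.le_mk_of_comm _ hφ
  have hge : Subobject.mk φ ≤ K := by
    refine hK.2 ⟨(s ≫ cokernel.π M.arrow) ≫ (Subobject.underlyingIso φ).inv, ?_, ?_⟩ hle
    · rw [Category.assoc, Subobject.underlyingIso_arrow, hφs]
    · intro Z g hg
      rw [Category.assoc] at hg
      have := hMess _ hg
      have h : g = (Subobject.underlyingIso φ).hom ≫ (Subobject.underlyingIso φ).inv ≫ g := by simp
      rw [h]
      exact mono_comp _ _
  let ψ : cokernel M.arrow ⟶ K := K.factorThru φ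
    (Subobject.factors_of_le _ hge ((Subobject.mk_factors_iff _ _).2 ⟨𝟙 _, Category.id_comp _⟩))
  have hψ : ψ ≫ K.arrow = φ := Subobject.factorThru_arrow _ _ _
  have hret : K.arrow ≫ cokernel.π M.arrow ≫ ψ = 𝟙 _ := by
    rw [← cancel_mono K.arrow, Category.assoc, Category.assoc, hψ, Category.id_comp,
      ← Category.assoc, hφ]
  have hinj : Injective (K : D) := Retract.injective ⟨K.arrow, cokernel.π M.arrow ≫ ψ, hret⟩
  refine ⟨K, t, ?_, hinj, fun Z g hg => hKess g fun h0 => hX ?_⟩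
  · have : Mono (t ≫ K.arrow) := by rw [ht]; infer_instance
    exact mono_of_mono t K.arrow
  · rw [← cancel_mono (t ≫ g), h0, comp_zero, comp_zero]

/-- An injective hull of a simple object is an essential extension. -/
lemma IsCompactEmbedding.essential_hom {X : C} [Simple X] {I : D} {ι : T.obj X ⟶ I}
    (hι : IsInjectiveHull ι) ⦃Z : D⦄ (g : I ⟶ Z) (hg : ι ≫ g ≠ 0) : Mono g :=
  have := hT.mono_of_ne_zero _ hg
  hι.essential g this

end InjectiveHulls

/-! ### Truncating the injective hull -/

section Gamma

open Abelian

variable {C : Type u} [Category.{v} C] [Abelian C] [HasExt.{w} C] {Λ : Type*} [PartialOrder Λ]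
  {D : Type*} [Category* D] [Abelian D] {T : C ⥤ D} (hT : IsCompactEmbedding T)
  {L nabla : Λ → C} (hL : IsSimpleLabelling L)

include hT

include hL in
/-- A partial hull of `L a` is the largest subobject in `C_Ω` of the injective hull of `L a`. -/
theorem IsPartialHull.exists_gamma {Ω : Set Λ} {a : Λ} {J : C} {j : L a ⟶ J}
    (hJ : IsPartialHull.{w} L nabla Ω Ω j) {I : D} {ι : T.obj (L a) ⟶ I} (hι : IsInjectiveHull ι) :
    ∃ g : T.obj J ⟶ I, Mono g ∧ ∀ X, serreSub L Ω X → ∀ f : T.obj X ⟶ I,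
      ∃ h : X ⟶ J, T.map h ≫ g = f := by
  have := hT.full
  have := hT.faithful
  have := hT.additive
  have := hT.preservesFiniteLimits
  have := hT.preservesFiniteColimits
  have := hι.mono
  have := hι.injective
  have := hJ.mono
  have := hL.simple a
  have := hT.mono_map j
  let g : T.obj J ⟶ I := Injective.factorThru ι (T.map j)
  have hg : T.map j ≫ g = ι := Injective.comp_factorThru _ _
  have hι0 : ι ≠ 0 := fun h => id_nonzero (L a) (T.map_injective (by
    rw [← cancel_mono ι, h, comp_zero, comp_zero]))
  refine ⟨g, hT.mono_of_forall g fun W u hu => ?_, fun X hX => ?_⟩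
  · obtain ⟨u, rfl⟩ := T.map_surjective u
    by_contra h0
    have hi : Abelian.image.ι u ≠ 0 := fun h => h0 (by
      rw [← Abelian.image.fac u, h, comp_zero, T.map_zero])
    obtain ⟨y, hy⟩ := exists_factor_of_essential j hJ.essential (Abelian.image.ι u) hi
    have := hT.epi_map (Abelian.factorThruImage u)
    refine hι0 ?_
    rw [← hg, ← hy, T.map_comp, Category.assoc]
    have : T.map (Abelian.image.ι u) ≫ g = 0 := by
      rw [← cancel_epi (T.map (Abelian.factorThruImage u)), ← Category.assoc, ← T.map_comp,
        Abelian.image.fac, hu, comp_zero]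
    rw [this, comp_zero]
  · refine serreSub_induction (fun a _ => hL.simple a) hX
      (fun X => ∀ f : T.obj X ⟶ I, ∃ h : X ⟶ J, T.map h ≫ g = f) ?_ ?_ ?_
    · exact fun X hX f => ⟨0, (T.map_isZero hX).eq_of_src _ _⟩
    · intro c _ f
      by_cases hf : f = 0
      · exact ⟨0, by rw [hf, T.map_zero, zero_comp]⟩
      · have := hL.simple c
        have := hT.mono_of_ne_zero f hf
        obtain ⟨u, hu⟩ := exists_factor_of_essential ι (hT.essential_hom hι) f hf
        obtain ⟨u, rfl⟩ := T.map_surjective u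
        have hu0 : u ≠ 0 := fun h => hι0 (by rw [← hu, h, T.map_zero, zero_comp])
        have := isIso_of_hom_simple hu0
        refine ⟨inv u ≫ j, ?_⟩
        rw [T.map_comp, Category.assoc, hg, ← hu, ← Category.assoc, ← T.map_comp,
          IsIso.inv_hom_id, T.map_id, Category.id_comp]
    -- The factorization on `S.X₁` extends to `S.X₂` because `J` is injective in `C_Ω`; the
    -- difference from `f` descends to `S.X₃`.
    · intro S hS _ h₃ H₁ H₃ f
      obtain ⟨y, hy⟩ := H₁ (T.map S.f ≫ f)
      obtain ⟨y', rfl⟩ := exists_hom_extension hS (hJ.ext_one _ h₃) y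
      obtain ⟨f', hf'⟩ := desc_of_shortExact (hS.map_of_exact T) (f - T.map y' ≫ g) (by
        change T.map S.f ≫ _ = 0
        rw [Preadditive.comp_sub, ← hy, T.map_comp, Category.assoc, sub_self])
      obtain ⟨z, hz⟩ := H₃ f'
      refine ⟨y' + S.g ≫ z, ?_⟩
      rw [T.map_add, Preadditive.add_comp, T.map_comp, Category.assoc, hz]
      change T.map S.g ≫ f' = _ at hf'
      rw [hf', add_sub_cancel]

omit [HasExt.{w} C]

include hL in
/-- The injective hull of `L a` is the directed union of its largest subobjects in `C_Ω`. -/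
theorem exists_directed_union (hC : FiniteLength C) (hΛ : ∀ a : Λ, (Set.Iic a).Finite) {a : Λ}
    {I : D} (h : ∀ Ω : Set Λ, IsLowerSet Ω → Ω.Finite → a ∈ Ω → ∃ (J : C) (g : T.obj J ⟶ I),
      Mono g ∧ serreSub L Ω J ∧ IsFiltered nabla (Set.Ici a) J ∧
      ∀ X, serreSub L Ω X → ∀ f : T.obj X ⟶ I, ∃ h : X ⟶ J, T.map h ≫ g = f) :
    ∃ 𝒮 : Set (Subobject I), 𝒮.Nonempty ∧ DirectedOn (· ≤ ·) 𝒮 ∧ IsLUB 𝒮 ⊤ ∧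
      ∀ S ∈ 𝒮, ∃ X : C, Nonempty (T.obj X ≅ (S : D)) ∧ IsFiltered nabla (Set.Ici a) X := by
  let 𝒮 : Set (Subobject I) := {S | ∃ (Ω : Set Λ) (J : C) (g : T.obj J ⟶ I) (_ : Mono g),
    IsLowerSet Ω ∧ Ω.Finite ∧ a ∈ Ω ∧ serreSub L Ω J ∧ IsFiltered nabla (Set.Ici a) J ∧
    (∀ X, serreSub L Ω X → ∀ f : T.obj X ⟶ I, ∃ h : X ⟶ J, T.map h ≫ g = f) ∧
    S = Subobject.mk g}
  refine ⟨𝒮, ?_, ?_, ⟨fun S _ => le_top, fun U hU => ?_⟩, ?_⟩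
  · obtain ⟨J, g, hg, h₁, h₂, h₃⟩ := h (Set.Iic a) (isLowerSet_Iic a) (hΛ a) Set.self_mem_Iic
    exact ⟨_, Set.Iic a, J, g, hg, isLowerSet_Iic a, hΛ a, Set.self_mem_Iic, h₁, h₂, h₃, rfl⟩
  · rintro _ ⟨Ω₁, J₁, g₁, _, hl₁, hf₁, ha₁, hm₁, -, -, rfl⟩ _
      ⟨Ω₂, J₂, g₂, _, hl₂, hf₂, ha₂, hm₂, -, -, rfl⟩
    obtain ⟨J, g, hg, h₁, h₂, h₃⟩ := h (Ω₁ ∪ Ω₂) (hl₁.union hl₂) (hf₁.union hf₂) (Or.inl ha₁)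
    refine ⟨_, ⟨Ω₁ ∪ Ω₂, J, g, hg, hl₁.union hl₂, hf₁.union hf₂, Or.inl ha₁, h₁, h₂, h₃, rfl⟩,
      ?_, ?_⟩
    · obtain ⟨y, hy⟩ := h₃ J₁ (serreSub_mono L Set.subset_union_left _ hm₁) g₁
      exact Subobject.mk_le_mk_of_comm _ hy
    · obtain ⟨y, hy⟩ := h₃ J₂ (serreSub_mono L Set.subset_union_right _ hm₂) g₂
      exact Subobject.mk_le_mk_of_comm _ hy
  · have h0 : cokernel.π U.arrow = 0 := by
      refine hT.separating _ fun Z u => ?_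
      obtain ⟨F, hF, hZ⟩ := hC.exists_serreSub hL Z
      -- The ideal generated by `a` and labels for `Z` is finite because the order is lower finite.
      let Ω : Set Λ := ⋃ b ∈ insert a F, Set.Iic b
      have hsub : insert a F ⊆ Ω := fun b hb => Set.mem_biUnion hb Set.self_mem_Iic
      have hlow : IsLowerSet Ω := isLowerSet_iUnion₂ fun b _ => isLowerSet_Iic b
      have hfin : Ω.Finite := (hF.insert a).biUnion fun b _ => hΛ b
      have ha : a ∈ Ω := hsub (Set.mem_insert a F)
      obtain ⟨J, g, hg, h₁, h₂, h₃⟩ := h Ω hlow hfin ha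
      obtain ⟨y, rfl⟩ := h₃ Z (serreSub_mono L ((Set.subset_insert a F).trans hsub) _ hZ) u
      have hle : Subobject.mk g ≤ U := hU ⟨Ω, J, g, hg, hlow, hfin, ha, h₁, h₂, h₃, rfl⟩
      rw [← Subobject.ofMkLE_arrow hle, Category.assoc, Category.assoc, cokernel.condition,
        comp_zero, comp_zero]
    have : Epi U.arrow := Preadditive.epi_of_cokernel_zero h0
    have : IsIso U.arrow := isIso_of_mono_of_epi _
    exact ((Subobject.isIso_arrow_iff_eq_top U).1 this).ge
  · rintro _ ⟨Ω, J, g, _, -, -, -, -, hJ, -, rfl⟩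
    exact ⟨J, ⟨(Subobject.underlyingIso g).symm⟩, hJ⟩

end Gamma

/-! ### Costandard objects from the ind-injective hulls -/

section Star

open Abelian

variable {C : Type u} [Category.{v} C] [Abelian C] {Λ : Type*} [PartialOrder Λ]
  {D : Type*} [Category* D] [Abelian D] {T : C ⥤ D} (hT : IsCompactEmbedding T)
  {L nabla : Λ → C} (hL : IsSimpleLabelling L)

/-- A subobject in `C_Ω` of an object with costandard filtration, where `a` is maximal in `Ω`. -/
lemma serreSub_Iic_of_mono (hmem : ∀ a, serreSub L (Set.Iic a) (nabla a)) {Ω : Set Λ} {a : Λ}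
    (hmax : Maximal (· ∈ Ω) a)
    (hz : ∀ b ∉ Ω, ∀ X, serreSub L Ω X → ∀ f : X ⟶ nabla b, f = 0) {Y : C}
    (hY : IsFiltered nabla (Set.Ici a) Y) : ∀ (M : C) (m : M ⟶ Y), Mono m → serreSub L Ω M →
      serreSub L (Set.Iic a) M := by
  refine hY.induction (fun Y => ∀ (M : C) (m : M ⟶ Y), Mono m → serreSub L Ω M →
      serreSub L (Set.Iic a) M) ?_ ?_
  · exact fun Y hY M m _ _ => (serreSub L _).prop_of_isZero
      ((IsZero.iff_id_eq_zero M).2 (by rw [← cancel_mono m]; exact hY.eq_of_tgt _ _))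
  · intro S hS _ ih b hb e M m _ hM
    obtain ⟨K, N, f, g, w, x, y, hE, hx, hy⟩ := shortExact_image_left hS m
    have := hE.mono_f
    have := hE.epi_g
    have hK : serreSub L Ω K := (serreSub L Ω).prop_of_mono f hM
    have hN : serreSub L Ω N := (serreSub L Ω).prop_of_epi g hM
    refine (serreSub L _).prop_X₂_of_shortExact hE (ih K x hx hK) ?_
    -- A layer ∇(b) with `b ≠ a` has `b ∉ Ω` by maximality of `a`, so it receives nothing from
    -- `C_Ω`.
    by_cases hba : b = a
    · subst hba
      exact (serreSub L _).prop_of_mono (y ≫ e.hom) (hmem b)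
    · have hb' : b ∉ Ω := fun h => hba (le_antisymm (hmax.2 h hb) hb)
      have h0 := hz b hb' N hN (y ≫ e.hom)
      refine (serreSub L _).prop_of_isZero ((IsZero.iff_id_eq_zero N).2 ?_)
      rw [← cancel_mono (y ≫ e.hom), h0, comp_zero, comp_zero]

variable {I : Λ → D} {ι : ∀ a, T.obj (L a) ⟶ I a} {g : ∀ a, T.obj (nabla a) ⟶ I a}
  (hι : ∀ a, IsInjectiveHull (ι a))
  (hmem : ∀ a, serreSub L (Set.Iic a) (nabla a))
  (hg : ∀ a X, serreSub L (Set.Iic a) X → ∀ f : T.obj X ⟶ I a, ∃! h : X ⟶ nabla a,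
    T.map h ≫ g a = f)
  (hU : ∀ a X (f : T.obj X ⟶ I a), ∃ (Y : C) (m : T.obj Y ⟶ I a) (h : X ⟶ Y), Mono m ∧
    IsFiltered nabla (Set.Ici a) Y ∧ T.map h ≫ m = f)

include hT hmem hg in
-- Uniqueness in the universal property, applied to the image of a morphism killed by `g a`.
lemma mono_gamma (a : Λ) : Mono (g a) := by
  have := hT.full
  have := hT.additive
  refine hT.mono_of_forall _ fun W u hu => ?_
  obtain ⟨u, rfl⟩ := T.map_surjective u
  have := hT.epi_map (Abelian.factorThruImage u)
  have h0 : T.map (Abelian.image.ι u) ≫ g a = 0 := by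
    rw [← cancel_epi (T.map (Abelian.factorThruImage u)), ← Category.assoc, ← T.map_comp,
      Abelian.image.fac, hu, comp_zero]
  have hi : Abelian.image.ι u = 0 :=
    (hg a _ ((serreSub L _).prop_of_mono (Abelian.image.ι u) (hmem a)) 0).unique h0 (by
      rw [T.map_zero, zero_comp])
  rw [← Abelian.image.fac u, hi, comp_zero, T.map_zero]

variable [HasExt.{w} C]

include hT hL hι hmem hg hU in
-- To split an extension `E` of an object of `C_Ω` by ∇(a), the map ∇(a) → I(a) is extended to `E`.
-- Its image lies in a ∇-filtered subobject, hence in `C_{≤ a}`, and so it factors through ∇(a).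
theorem exists_isCostandard : ∃ i : ∀ a, L a ⟶ nabla a, IsCostandard.{w} L nabla i := by
  have := hT.full
  have := hT.faithful
  have := hT.additive
  choose i hi _ using fun a => hg a (L a) (serreSub_mem L Set.self_mem_Iic) (ι a)
  dsimp at hi
  have hgm := mono_gamma hT hmem hg
  have hmono : ∀ a, Mono (i a) := fun a => by
    have := (hι a).mono
    have : Mono (T.map (i a) ≫ g a) := by rwa [hi]
    have := mono_of_mono (T.map (i a)) (g a)
    exact T.mono_of_mono_map this
  have hess : ∀ a ⦃Z : C⦄ (f : nabla a ⟶ Z), i a ≫ f ≠ 0 → Mono f := by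
    intro a Z f hf
    have := hL.simple a
    by_contra hnm
    have hκ : kernel.ι f ≠ 0 := fun h => hnm (Preadditive.mono_of_kernel_zero h)
    have := hT.mono_map (kernel.ι f)
    have hκ' : T.map (kernel.ι f) ≫ g a ≠ 0 := fun h => hκ (T.map_injective (by
      rw [← cancel_mono (g a), h, T.map_zero, zero_comp]))
    obtain ⟨u, hu⟩ := exists_factor_of_essential (ι a) (hT.essential_hom (hι a))
      (T.map (kernel.ι f) ≫ g a) hκ'
    obtain ⟨u, rfl⟩ := T.map_surjective u
    have : u ≫ kernel.ι f = i a := T.map_injective (by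
      rw [← cancel_mono (g a), hi, ← hu, T.map_comp, Category.assoc])
    refine hf ?_
    rw [← this, Category.assoc, kernel.condition, comp_zero]
  refine ⟨i, hmem, hmono, hess, fun a Ω hΩ _ hmax X hX =>
    ext_one_subsingleton_of_split fun E f p w hS => ?_⟩
  have hE : serreSub L Ω E := (serreSub L Ω).prop_X₂_of_shortExact hS
    (serreSub_mono L (hΩ.Iic_subset hmax.prop) _ (hmem a)) hX
  have := hS.mono_f
  have := hT.mono_map f
  have := (hι a).injective
  let e : T.obj E ⟶ I a := Injective.factorThru (g a) (T.map f)
  have he : T.map f ≫ e = g a := Injective.comp_factorThru _ _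
  obtain ⟨Y, m, h, hm, hY, hh⟩ := hU a E e
  have hM : serreSub L (Set.Iic a) (Abelian.image h) :=
    serreSub_Iic_of_mono hmem hmax
      (fun b hb X hX f => hom_eq_zero_of_essential hL (i b) (hmono b) (hess b) hb hX f) hY _
      (Abelian.image.ι h) inferInstance
      ((serreSub L Ω).prop_of_epi (Abelian.factorThruImage h) hE)
  obtain ⟨r, hr, -⟩ := hg a _ hM (T.map (Abelian.image.ι h) ≫ m)
  have hret : f ≫ Abelian.factorThruImage h ≫ r = 𝟙 _ := T.map_injective (by
    rw [← cancel_mono (g a), T.map_comp, T.map_comp, Category.assoc, Category.assoc, hr,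
      ← Category.assoc (T.map _) _ m, ← T.map_comp, Abelian.image.fac, hh, he, T.map_id,
      Category.id_comp])
  exact ⟨(ShortComplex.Splitting.ofExactOfRetraction _ hS.exact _ hret hS.epi_g).s,
    (ShortComplex.Splitting.ofExactOfRetraction _ hS.exact _ hret hS.epi_g).s_g⟩

end Star

/-! ### Reordering costandard filtrations -/

section Rearrange

open Abelian

variable {C : Type u} [Category.{v} C] [Abelian C] [HasExt.{w} C] {Λ : Type*} [PartialOrder Λ]
  {L nabla : Λ → C} {i : ∀ a, L a ⟶ nabla a} (hΛ : ∀ a : Λ, (Set.Iic a).Finite)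

include hΛ in
/-- The copies of `nabla b` in a costandard filtration can be moved to the bottom. -/
lemma IsCostandard.exists_rearrangement (hN : IsCostandard.{w} L nabla i) {b : Λ} {Y : C}
    (hY : IsFiltered nabla (Set.Ici b) Y) :
    ∃ (Y' Y'' : C) (y : Y' ⟶ Y) (q : Y ⟶ Y'') (w : y ≫ q = 0),
      (ShortComplex.mk y q w).ShortExact ∧ IsFiltered nabla {b} Y' ∧
      IsFiltered nabla (Set.Ioi b) Y'' := by
  refine hY.induction (fun Y => ∃ (Y' Y'' : C) (y : Y' ⟶ Y) (q : Y ⟶ Y'') (w : y ≫ q = 0),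
      (ShortComplex.mk y q w).ShortExact ∧ IsFiltered nabla {b} Y' ∧
      IsFiltered nabla (Set.Ioi b) Y'') ?_ ?_
  · intro Y hY
    exact ⟨Y, _, 𝟙 Y, cokernel.π (𝟙 Y), cokernel.condition _, shortExact_of_mono (𝟙 Y), .zero hY,
      .zero (isZero_cokernel_of_epi (𝟙 Y))⟩
  · rintro S hS - ⟨Y', Y'', y, q, w, hE, hY', hY''⟩ c hc e
    obtain ⟨Q, f, g, w₁, p, w₂, hQ, hp, -⟩ := exists_shortExact_quotient hS hE
    -- A top layer ∇(b) splits off the quotient `Q`, since Ext¹(∇(b), ∇(d)) = 0 for `d > b`, and its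
    -- preimage joins `Y'`. Any other top layer stays in the quotient.
    by_cases hcb : c = b
    · subst hcb
      have : Subsingleton (Ext.{w} S.X₃ Y'' 1) := by
        refine ext_subsingleton_of_isFiltered hY'' fun d hd => ?_
        exact prop_of_iso_of_ext (P := fun X => Subsingleton (Ext.{w} X (nabla d) 1))
          (fun _ => ext_subsingleton_of_isZero_left 1) (fun _ hS => ext_subsingleton_left₂ hS)
          e.symm (ext_one_costandard_costandard hΛ hN (lt_asymm hd))
      obtain ⟨s, hs⟩ := exists_hom_lift hQ this (𝟙 _)
      let σ := ShortComplex.Splitting.ofExactOfSection _ hQ.exact s hs hQ.mono_f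
      have hσ : (ShortComplex.mk σ.s σ.r σ.s_r).ShortExact :=
        ShortComplex.Splitting.shortExact
          { r := g
            s := f
            f_r := σ.s_g
            s_g := σ.f_r
            id := (add_comm _ _).trans σ.id }
      obtain ⟨Z, f', g', w₁', z, w₂', hZ, hz, -⟩ := exists_shortExact_preimage hp hσ
      exact ⟨Z, Y'', z, p ≫ σ.r, w₂', hz, .cons hZ hY' rfl e, hY''⟩
    · exact ⟨Y', Q, y ≫ S.f, p, w₂, hp, hY', .cons hQ hY'' (lt_of_le_of_ne hc (Ne.symm hcb)) e⟩

end Rearrange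

/-! ### Vanishing of the second Ext group -/

section ExtTwo

open Abelian

variable {C : Type u} [Category.{v} C] [Abelian C] [HasExt.{w} C]

/-- Every class in `Ext²(X, Y)` is killed by the pushout along some monomorphism from `Y`. -/
lemma exists_mono_comp_eq_zero {X Y : C} (e : Ext X Y 2) :
    ∃ (E : C) (f : Y ⟶ E), Mono f ∧ e.comp (Ext.mk₀ f) (add_zero 2) = 0 := by
  -- Dimension shifting writes `e` as a Yoneda product with the class of an extension of the kernel
  -- of `p` by `Y`; that class dies in its own middle term.
  obtain ⟨X', p, hp, h⟩ := exists_epi_comp_eq_zero e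
  obtain ⟨e', rfl⟩ := Ext.contravariant_sequence_exact₃ (shortExact_of_epi p) Y e h
    (show 1 + 1 = 2 from rfl)
  obtain ⟨E, f, g, w, hE, rfl⟩ := exists_extClass_eq e'
  refine ⟨E, f, hE.mono_f, ?_⟩
  rw [Ext.comp_assoc _ _ _ (show 1 + 1 = 2 from rfl) (add_zero 1) (by norm_num)]
  have := hE.extClass_comp
  dsimp at this
  rw [this, Ext.comp_zero]

variable {Λ : Type*} [PartialOrder Λ] {D : Type*} [Category* D] [Abelian D] {T : C ⥤ D}
  (hT : IsCompactEmbedding T) {L nabla delta : Λ → C} (hL : IsSimpleLabelling L)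
  {i : ∀ a, L a ⟶ nabla a} {p : ∀ a, delta a ⟶ L a} {I : Λ → D}
  {ι : ∀ a, T.obj (L a) ⟶ I a} {g : ∀ a, T.obj (nabla a) ⟶ I a}

include hT hL in
/-- `Ext²` between standard and costandard objects vanishes if the injective hulls are unions of
objects with costandard filtrations. -/
theorem ext_two_standard_costandard (hΛ : ∀ a : Λ, (Set.Iic a).Finite)
    (hN : IsCostandard.{w} L nabla i) (hD : IsStandard.{w} L delta p)
    (hι : ∀ a, IsInjectiveHull (ι a))
    (hg : ∀ a X, serreSub L (Set.Iic a) X → ∀ f : T.obj X ⟶ I a, ∃! h : X ⟶ nabla a,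
      T.map h ≫ g a = f)
    (hU : ∀ a X (f : T.obj X ⟶ I a), ∃ (Y : C) (m : T.obj Y ⟶ I a) (h : X ⟶ Y), Mono m ∧
      IsFiltered nabla (Set.Ici a) Y ∧ T.map h ≫ m = f) (a b : Λ) :
    Subsingleton (Ext.{w} (delta a) (nabla b) 2) := by
  refine subsingleton_of_forall_eq 0 fun e => ?_
  have := hT.full
  have := hT.faithful
  have hgm := mono_gamma hT hN.mem hg
  obtain ⟨E, f, hf, hef⟩ := exists_mono_comp_eq_zero e
  have := hT.mono_map f
  have := (hι b).injective
  obtain ⟨Y, m, h, hm, hY, hh⟩ := hU b E (Injective.factorThru (g b) (T.map f))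
  obtain ⟨Y', Y'', y, q, w, hS, hY', hY''⟩ := hN.exists_rearrangement hΛ hY
  -- There are no nonzero maps from ∇(b) to ∇(c) for `c > b`, so ∇(b) lands in `Y'`.
  have hz : (f ≫ h) ≫ q = 0 := by
    have key : ∀ t : nabla b ⟶ Y'', t = 0 := by
      refine hY''.induction (fun Y => ∀ t : nabla b ⟶ Y, t = 0)
        (fun Y hY t => hY.eq_of_tgt _ _) fun S hS _ ih c hc e t => ?_
      have h0 : t ≫ S.g ≫ e.hom = 0 :=
        hN.hom_eq_zero hL (Ω := Set.Iic b) (not_le_of_gt hc) (hN.mem b) _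
      have h1 : t ≫ S.g = 0 := by
        rw [← cancel_mono e.hom, Category.assoc, h0, zero_comp]
      obtain ⟨t', rfl⟩ := lift_of_shortExact hS t h1
      rw [ih t', zero_comp]
    exact key _
  obtain ⟨t, ht⟩ := lift_of_shortExact hS _ hz
  dsimp at t ht
  -- Hence `Y' ⟶ I b` factors through ∇(b), which provides a retraction of `t`.
  have hmem : serreSub L (Set.Iic b) Y' := by
    refine hY'.induction (serreSub L (Set.Iic b)) (fun _ => (serreSub L _).prop_of_isZero)
      fun S hS _ ih c hc θ => ?_
    obtain rfl : c = b := hc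
    exact (serreSub L _).prop_X₂_of_shortExact hS ih ((serreSub L _).prop_of_iso θ.symm (hN.mem c))
  obtain ⟨r, hr, -⟩ := hg b _ hmem (T.map y ≫ m)
  have htr : t ≫ r = 𝟙 _ := T.map_injective (by
    rw [← cancel_mono (g b), T.map_comp, Category.assoc, hr, ← Category.assoc, ← T.map_comp, ht,
      T.map_comp, Category.assoc, hh, Injective.comp_factorThru, T.map_id, Category.id_comp])
  have : Subsingleton (Ext.{w} (delta a) Y'' 1) :=
    ext_subsingleton_of_isFiltered hY'' fun d _ => ext_one_standard_costandard hΛ hN hD a d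
  -- The class dies in `Y`, so its image in Ext²(Δ(a), Y') comes from Ext¹(Δ(a), Y''), which is
  -- zero.
  have h₁ : (e.comp (Ext.mk₀ t) (add_zero 2)).comp (Ext.mk₀ y) (add_zero 2) = 0 := by
    rw [Ext.comp_assoc_of_third_deg_zero, Ext.mk₀_comp_mk₀, ht, ← Ext.mk₀_comp_mk₀,
      ← Ext.comp_assoc_of_third_deg_zero, hef, Ext.zero_comp]
  obtain ⟨z, hz⟩ := Ext.covariant_sequence_exact₁ (delta a) hS _ h₁ (show 1 + 1 = 2 from rfl)
  have h₂ : e.comp (Ext.mk₀ t) (add_zero 2) = 0 := by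
    rw [← hz, Subsingleton.elim z 0, Ext.zero_comp]
  rw [← Ext.comp_mk₀_id e, ← htr, ← Ext.mk₀_comp_mk₀, ← Ext.comp_assoc_of_third_deg_zero, h₂,
    Ext.zero_comp]

end ExtTwo

/-! ### Passage between the two sets of conditions -/

section Conditions

open Abelian

variable {C : Type u} [Category.{v} C] [Abelian C] {Λ : Type*} [PartialOrder Λ] {L : Λ → C}
  (hL : IsSimpleLabelling L) {delta nabla : ∀ a : Λ, Trunc L (Set.Iic a)}

include hL

omit [PartialOrder Λ] in
lemma simple_truncSimple {Ω : Set Λ} {a : Λ} (ha : a ∈ Ω) : Simple (truncSimple L ha) where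
  mono_isIso_iff_nonzero {Y} f _ := by
    have := hL.simple a
    have := trunc_mono_hom f
    refine ⟨fun _ h => ?_, fun h => ?_⟩
    · have : IsIso f.hom := inferInstanceAs (IsIso ((serreSub L Ω).ι.map f))
      exact (Simple.mono_isIso_iff_nonzero f.hom).1 this (congrArg (fun f : Y ⟶ truncSimple L ha => f.hom) h)
    · have : IsIso ((serreSub L Ω).ι.map f) :=
        isIso_of_mono_of_nonzero (f := f.hom) fun h0 => h (ObjectProperty.hom_ext _ h0)
      exact isIso_of_reflects_iso f (serreSub L Ω).ι

section Systems

variable [HasExt.{w} C]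

lemma isCostandard_of_isInjectiveHull
    {i : ∀ a, truncSimple L (Set.self_mem_Iic (a := a)) ⟶ nabla a} (hi : ∀ a, IsInjectiveHull (i a))
    (h : ∀ (a : Λ) (Ω : Set Λ) (hΩ : IsLowerSet Ω), Ω.Finite → ∀ ha : Maximal (· ∈ Ω) a,
        Injective ((truncIncl L (hΩ.Iic_subset ha.prop)).obj (nabla a))) :
    IsCostandard.{w} L (fun a => (nabla a).obj) fun a => (i a).hom where
  mem a := (nabla a).property
  mono a := have := (hi a).mono; trunc_mono_hom (i a)
  essential a := (hi a).essential_hom hL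
  ext_one a Ω hΩ hfin ha := (trunc_injective_iff _).1 (h a Ω hΩ hfin ha)

lemma isStandard_of_isProjectiveCover
    {p : ∀ a, delta a ⟶ truncSimple L (Set.self_mem_Iic (a := a))}
    (hp : ∀ a, IsProjectiveCover (p a)) :
    IsStandard.{w} L (fun a => (delta a).obj) fun a => (p a).hom where
  mem a := (delta a).property
  epi a := have := (hp a).epi; trunc_epi_hom (p a)
  superfluous a := (hp a).superfluous_hom hL
  ext_one a := (trunc_projective_iff _).1 (hp a).projective

end Systems

lemma DaggerConditions.exists_systems (h : DaggerConditions L delta nabla) :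
    letI : HasExt.{max u v} C := HasExt.standard C
    (∃ i, IsCostandard.{max u v} L (fun a => (nabla a).obj) i) ∧
      (∃ p, IsStandard.{max u v} L (fun a => (delta a).obj) p) ∧
      ∀ a b, Subsingleton (Ext.{max u v} (delta a).obj (nabla b).obj 2) := by
  let : HasExt.{max u v} C := HasExt.standard C
  choose i hi using fun a => (h a).1.1
  choose p hp using fun a => (h a).1.2
  exact ⟨⟨_, isCostandard_of_isInjectiveHull hL hi fun a => (h a).2.1.2⟩,
    ⟨_, isStandard_of_isProjectiveCover hL hp⟩,
    fun a b => subsingleton_of_forall_eq 0 ((h a).2.2 b)⟩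

/-- The additional conditions of Riche and Williamson are automatic. -/
theorem DaggerConditions.rwConditions (hΛ : ∀ a : Λ, (Set.Iic a).Finite)
    (h : DaggerConditions L delta nabla) : RWConditions L delta := by
  let : HasExt.{max u v} C := HasExt.standard C
  obtain ⟨⟨i, hN⟩, ⟨p, hD⟩, -⟩ := h.exists_systems hL
  have hm : ∀ a, HasMultiplicity (nabla a).obj (L a) 1 := fun a => (h a).2.1.1
  refine fun a => ⟨?_, fun Ω hΩ _ ha => ?_⟩
  · have := hD.epi a
    exact hasMultiplicity_one hL (shortExact_of_epi (p a)) (Iso.refl _)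
      (hD.kernel_mem hL hN hm hΛ a)
  · exact (trunc_projective_iff _).2 fun X hX => hD.ext_one_of_maximal hL hN hm hΛ ha hX

variable (k : Type*) [Field k] [Linear k C] [EssentiallySmall.{w} C]
  (hC : IsFiniteLengthCategory k C) (hΛ : ∀ a : Λ, (Set.Iic a).Finite)

include hC hΛ

/-- The `†`-conditions imply the `∗`-conditions. -/
theorem DaggerConditions.isLowerFiniteHWStar (h : DaggerConditions L delta nabla) :
    IsLowerFiniteHWStar.{w} k L := by
  let : HasExt.{max u v} C := HasExt.standard C
  obtain ⟨⟨i, hN⟩, ⟨p, hD⟩, hE⟩ := h.exists_systems hL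
  have hm : ∀ a, HasMultiplicity (nabla a).obj (L a) 1 := fun a => (h a).2.1.1
  have hC' : FiniteLength C := ⟨hC.noetherian, hC.artinian⟩
  have hT := isCompactEmbedding_toInd.{w} (C := C)
  choose I ι hι using fun a => have := hL.simple a; hT.exists_isInjectiveHull (L a)
  have hull : ∀ (a : Λ) (Ω : Set Λ), IsLowerSet Ω → Ω.Finite → a ∈ Ω → ∃ (J : C) (j : L a ⟶ J),
      IsPartialHull.{max u v} L (fun a => (nabla a).obj) Ω Ω j := fun a Ω hΩ hfin ha =>
    exists_isPartialHull hL hΛ k hC.finite_hom hC' hN hD hm hE hΩ hfin ha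
  have hmax : ∀ a : Λ, Maximal (· ∈ Set.Iic a) a := fun a => ⟨le_rfl, fun _ h _ => h⟩
  have := hT.faithful
  choose g hgm hg using fun a =>
    (hN.isPartialHull (isLowerSet_Iic a) (hΛ a) (hmax a)).exists_gamma hT hL (hι a)
  refine ⟨I, ι, nabla, g, hι, fun a X f => ?_, fun a => ⟨?_, hm a, ?_⟩⟩
  · obtain ⟨y, hy⟩ := hg a X.obj X.property f
    have := hgm a
    exact ⟨y, hy, fun z hz => (toInd C).map_injective ((cancel_mono (g a)).1 (hz.trans hy.symm))⟩
  · refine isFiniteCategory_trunc k hC hL (hΛ a) fun b hb => ?_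
    obtain ⟨J, j, hJ⟩ := hull b (Set.Iic a) (isLowerSet_Iic a) (hΛ a) hb
    exact ⟨⟨J, hJ.mem⟩, j, (trunc_injective_iff _).2 hJ.ext_one, hJ.mono⟩
  · obtain ⟨𝒮, h₁, h₂, h₃, h₄⟩ := exists_directed_union (nabla := fun a => (nabla a).obj) hT hL hC'
      hΛ (a := a) (I := I a) fun Ω hΩ hfin ha => by
        obtain ⟨J, j, hJ⟩ := hull a Ω hΩ hfin ha
        obtain ⟨g, hg, hgJ⟩ := hJ.exists_gamma hT hL (hι a)
        exact ⟨J, g, hg, hJ.mem, hJ.filtered, hgJ⟩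
    refine ⟨𝒮, h₁, h₂, h₃, fun S hS => ?_⟩
    obtain ⟨X, hX, l, hl, hQ⟩ := h₄ S hS
    exact ⟨X, l, hX, hl, hQ⟩

omit hC in
/-- The `∗`-conditions imply the `†`-conditions. -/
theorem IsLowerFiniteHWStar.isLowerFiniteHWDagger (h : IsLowerFiniteHWStar.{w} k L) :
    IsLowerFiniteHWDagger L := by
  let : HasExt.{max u v} C := HasExt.standard C
  obtain ⟨I, ι, nabla, g, hι, hg, h⟩ := h
  have hT := isCompactEmbedding_toInd.{w} (C := C)
  have hg' : ∀ a X, serreSub L (Set.Iic a) X → ∀ f : (toInd C).obj X ⟶ I a,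
      ∃! h : X ⟶ (nabla a).obj, (toInd C).map h ≫ g a = f := fun a X hX => hg a ⟨X, hX⟩
  have hU : ∀ a X (f : (toInd C).obj X ⟶ I a), ∃ (Y : C) (m : (toInd C).obj Y ⟶ I a) (h : X ⟶ Y),
      Mono m ∧ IsFiltered (fun a => (nabla a).obj) (Set.Ici a) Y ∧ (toInd C).map h ≫ m = f := by
    intro a X f
    obtain ⟨-, -, 𝒮, h₁, h₂, h₃, h₄⟩ := h a
    -- Compactness turns the directed union of (iii∗) into a factorization through a single filtered
    -- subobject.
    obtain ⟨S, hS, hf⟩ := hT.factors 𝒮 h₁ h₂ ⊤ h₃ X f (Subobject.top_factors f)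
    obtain ⟨Y, l, ⟨e⟩, hl, hQ⟩ := h₄ S hS
    have := hT.full
    obtain ⟨y, hy⟩ := (toInd C).map_surjective (S.factorThru f hf ≫ e.inv)
    refine ⟨Y, e.hom ≫ S.arrow, y, mono_comp _ _, ⟨l, hl, hQ⟩, ?_⟩
    rw [hy, Category.assoc, e.inv_hom_id_assoc, Subobject.factorThru_arrow]
  have hmem : ∀ a, serreSub L (Set.Iic a) (nabla a).obj := fun a => (nabla a).property
  obtain ⟨i, hN⟩ := exists_isCostandard.{max u v} hT hL hι hmem hg' hU
  choose delta p hp using fun a =>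
    have := simple_truncSimple hL (Set.self_mem_Iic (a := a))
    (h a).1.exists_isProjectiveCover k (truncSimple L (Set.self_mem_Iic (a := a)))
  have hD := isStandard_of_isProjectiveCover.{max u v} hL hp
  have hE := ext_two_standard_costandard hT hL hΛ hN hD hι hg' hU
  have hinj : ∀ (a : Λ) (Ω : Set Λ) (hΩ : IsLowerSet Ω), Ω.Finite → ∀ ha : Maximal (· ∈ Ω) a,
      Injective ((truncIncl L (hΩ.Iic_subset ha.prop)).obj (nabla a)) := fun a Ω hΩ hfin ha =>
    (trunc_injective_iff _).2 (hN.ext_one a Ω hΩ hfin ha)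
  refine ⟨delta, nabla, fun a => ⟨⟨⟨ObjectProperty.homMk (i a), ?_⟩, p a, hp a⟩,
    ⟨(h a).2.1, hinj a⟩, fun b e => @Subsingleton.elim _ (hE a b) e 0⟩⟩
  refine isInjectiveHull_of_essential hL _ (hN.mono a) ?_ (hN.essential a)
  exact hinj a (Set.Iic a) (isLowerSet_Iic a) (hΛ a) ⟨le_rfl, fun _ h _ => h⟩

end Conditions

end LFHW

theorem mainTheorem2 {k : Type*} [Field k] [IsAlgClosed k]
    {C : Type u} [Category.{v} C] [Abelian C] [Linear k C] [EssentiallySmall.{w} C]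
    (hC : LFHW.IsFiniteLengthCategory k C)
    {Λ : Type*} [PartialOrder Λ] (hΛ : ∀ a : Λ, (Set.Iic a).Finite)
    (L : Λ → C) (hL : LFHW.IsSimpleLabelling L) :
    (LFHW.IsLowerFiniteHWStar.{w} k L ↔ LFHW.IsLowerFiniteHWDagger L) ∧
      (LFHW.IsLowerFiniteHWDagger L ↔ LFHW.IsHighestWeightRW L) ∧
      ∀ delta nabla : ∀ a : Λ, LFHW.Trunc L (Set.Iic a),
        LFHW.DaggerConditions L delta nabla → LFHW.RWConditions L delta :=
  ⟨⟨fun h => h.isLowerFiniteHWDagger hL k hΛ,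
      fun ⟨_, _, h⟩ => h.isLowerFiniteHWStar hL k hC hΛ⟩,
    ⟨fun ⟨delta, nabla, h⟩ => ⟨delta, nabla, h, h.rwConditions hL hΛ⟩,
      fun ⟨delta, nabla, h, _⟩ => ⟨delta, nabla, h⟩⟩,
    fun _ _ h => h.rwConditions hL hΛ⟩
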